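/- Let $\mathbf{SCat}$ be the category of small simplicial categories (categories enriched over simplicial sets) and simplicial functors, let $\mathbf{RelCat}$ be the category of small relative categories (pairs consisting of a category and a subcategory of "weak equivalences" containing all objects and identity maps) and weak equivalence preserving functors, and let $\mathrm{s}\mathcal S$ be the category of simplicial spaces, i.e. bisimplicial sets. Consider the following functors. * The relativization functor $\mathrm{Rel}\colon \mathbf{SCat}\to\mathbf{RelCat}$ sends $\mathbf A$ to the category $b\mathbf A$ which has as objects the pairs $(p,A)$ of an integer $p\ge 0$ and an object $A\in\mathbf A$, and as maps $(p_1,A_1)\to(p_2,A_2)$ the pairs $(t,a)$ of a simplicial operator $t$ from dimension $p_1$ to dimension $p_2$ and a $p_2$-simplex $a$ of the simplicial set $\hom(A_1,A_2)$, with composition $(t',a')(t,a)=(t't,\,a'(t'a))$. The weak equivalences are the maps of the form $(t,\mathrm{id})$. * The simplicial nerve functor $N\colon\mathbf{RelCat}\to \mathrm{s}\mathcal S$ sends $X$ to the bisimplicial set which has as its $(p,q)$-bisimplices the relative functors $\hat p\times\check q\to X$, where $\hat p$ is the category $0\to\cdots\to p$ in which only the identity maps are weak equivalences, and $\check q$ is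 the category $0\to\cdots\to q$ in which all maps are weak equivalences. For fixed $p$, varying $q$, these form the space in dimension $p$. * The flipped nerve functor $Z\colon\mathbf{SCat}\to \mathrm{s}\mathcal S$ sends $\mathbf A$ to the simplicial space which in dimension $k\ge0$ is the simplicial set $\coprod_{A_0,\ldots,A_k}\hom(A_0,A_1)\times\cdots\times\hom(A_{k-1},A_k)$, where $A_0,\ldots,A_k$ run through all sequences of $k+1$ objects of $\mathbf A$, with the simplicial operators of the nerve (induced by composition and by insertion of identity maps). Call a map of simplicial spaces a Reedy equivalence if it is a weak (homotopy) equivalence of simplicial sets in every dimension. Then the two functors $$N\circ\mathrm{Rel}\quad\text{and}\quad Z\colon\ \mathbf{SCat}\longrightarrow \mathrm{s}\mathcal S$$ are naturally Reedy equivalent, i.e. they can be connected by a finite zigzag of natural transformations between functors $\mathbf{SCat}\to \mathrm{s}\mathcal S$ all of whose components are Reedy equivalences. -/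

import Mathlib

open CategoryTheory Opposite MonoidalCategory

universe v u v' u' v'' u''

/-! ### Simplicial categories -/

/-- Small simplicial categories, i.e. small categories enriched over simplicial sets. -/
def SCat : Type (u + 1) := EnrichedCat.{u, u + 1, u} SSet.{u}

namespace SCat

/-- The set of objects of a simplicial category. -/
def Obj (A : SCat.{u}) : Type u := Bundled.α A

instance enriched (A : SCat.{u}) : EnrichedCategory SSet.{u} A.Obj := Bundled.str A

/-- The category of small simplicial categories and simplicial functors. -/
instance : Category SCat.{u} where
  Hom A B := EnrichedFunctor SSet.{u} A.Obj B.Obj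
  id A := EnrichedFunctor.id SSet.{u} A.Obj
  comp F G := EnrichedFunctor.comp SSet.{u} F G

/-- The simplicial set of maps `a → b` in the simplicial category `A`. -/
abbrev hom (A : SCat.{u}) (a b : A.Obj) : SSet.{u} := EnrichedCategory.Hom a b

/-- The objects of the category `A_p` of `p`-simplices of `A`: they are the objects of `A`. -/
@[ext]
structure Level (A : SCat.{u}) (p : SimplexCategoryᵒᵖ) : Type u where
  /-- the underlying object of `A` -/
  obj : A.Obj

/-- The category `A_p`: its maps `a → b` are the `p`-simplices of the simplicial set of maps
from `a` to `b`. -/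
instance (A : SCat.{u}) (p : SimplexCategoryᵒᵖ) : Category.{u} (A.Level p) where
  Hom X Y := (A.hom X.obj Y.obj).obj p
  id X := (eId SSet.{u} X.obj).app p PUnit.unit
  comp {X Y Z} f g := (eComp SSet.{u} X.obj Y.obj Z.obj).app p (f, g)
  id_comp {X Y} f := ConcreteCategory.congr_hom
    (NatTrans.congr_app (EnrichedCategory.id_comp (V := SSet.{u}) X.obj Y.obj) p) f
  comp_id {X Y} f := ConcreteCategory.congr_hom
    (NatTrans.congr_app (EnrichedCategory.comp_id (V := SSet.{u}) X.obj Y.obj) p) f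
  assoc {W X Y Z} f g h := by
    have e := NatTrans.congr_app
      (EnrichedCategory.assoc (V := SSet.{u}) W.obj X.obj Y.obj Z.obj) p
    let x : (A.hom W.obj X.obj ⊗ A.hom X.obj Y.obj ⊗ A.hom Y.obj Z.obj).obj p := (f, (g, h))
    exact ConcreteCategory.congr_hom e x

/-- A simplicial operator `t` from dimension `p` to dimension `q` induces the functor
`A_p ⥤ A_q` that is the identity on objects and sends a map `a` to `ta`. -/
def levelMap (A : SCat.{u}) {p q : SimplexCategoryᵒᵖ} (t : p ⟶ q) : A.Level p ⥤ A.Level q where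
  obj X := ⟨X.obj⟩
  map {X Y} a := (A.hom X.obj Y.obj).map t a
  map_id X := (NatTrans.naturality_apply (eId SSet.{u} X.obj) t PUnit.unit).symm
  map_comp {X Y Z} f g := by
    let x : (A.hom X.obj Y.obj ⊗ A.hom Y.obj Z.obj).obj p := (f, g)
    exact (NatTrans.naturality_apply (eComp SSet.{u} X.obj Y.obj Z.obj) t x).symm

/-- A simplicial category, considered as a simplicial diagram of categories. -/
def diagram (A : SCat.{u}) : SimplexCategoryᵒᵖ ⥤ Cat.{u, u} where
  obj p := Cat.of (A.Level p)
  map t := (A.levelMap t).toCatHom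
  map_id p := by
    apply Cat.Hom.ext
    refine CategoryTheory.Functor.hext (fun _ => rfl) (fun X Y f => heq_of_eq ?_)
    exact ConcreteCategory.congr_hom ((A.hom X.obj Y.obj).map_id p) f
  map_comp s t := by
    apply Cat.Hom.ext
    refine CategoryTheory.Functor.hext (fun _ => rfl) (fun X Y f => heq_of_eq ?_)
    exact ConcreteCategory.congr_hom ((A.hom X.obj Y.obj).map_comp s t) f

/-- The functor `A_p ⥤ B_p` induced by a simplicial functor `A ⟶ B`. -/
def levelFunctor {A B : SCat.{u}} (F : A ⟶ B) (p : SimplexCategoryᵒᵖ) :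
    A.Level p ⥤ B.Level p where
  obj X := ⟨EnrichedFunctor.obj F X.obj⟩
  map {X Y} a := (EnrichedFunctor.map F X.obj Y.obj).app p a
  map_id X := ConcreteCategory.congr_hom
    (NatTrans.congr_app (EnrichedFunctor.map_id F X.obj) p) PUnit.unit
  map_comp {X Y Z} f g := by
    let x : (A.hom X.obj Y.obj ⊗ A.hom Y.obj Z.obj).obj p := (f, g)
    exact ConcreteCategory.congr_hom
      (NatTrans.congr_app (EnrichedFunctor.map_comp F X.obj Y.obj Z.obj) p) x

lemma levelFunctor_id (A : SCat.{u}) (p : SimplexCategoryᵒᵖ) :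
    levelFunctor (𝟙 A) p = 𝟭 _ := rfl

lemma levelFunctor_comp {A B C : SCat.{u}} (F : A ⟶ B) (G : B ⟶ C) (p : SimplexCategoryᵒᵖ) :
    levelFunctor (F ≫ G) p = levelFunctor F p ⋙ levelFunctor G p := rfl

/-- The simplicial diagram of categories, as a functor of the simplicial category. -/
def diagramFunctor : SCat.{u} ⥤ (SimplexCategoryᵒᵖ ⥤ Cat.{u, u}) where
  obj A := A.diagram
  map {A B} F :=
    { app := fun p => (levelFunctor F p).toCatHom
      naturality := fun p q t => by
        apply Cat.Hom.ext
        refine CategoryTheory.Functor.hext (fun _ => rfl) (fun X Y f => heq_of_eq ?_)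
        exact NatTrans.naturality_apply (EnrichedFunctor.map F X.obj Y.obj) t f }
  map_id A := rfl
  map_comp F G := rfl

end SCat

/-! ### Relative categories -/

/-- A relative category: a category together with a subcategory of weak equivalences that
contains all the objects and hence all the identity maps. -/
structure RelativeCat where
  /-- the objects -/
  Obj : Type u
  [cat : Category.{v} Obj]
  /-- the weak equivalences -/
  W : MorphismProperty Obj
  id_mem : ∀ X : Obj, W (𝟙 X)
  comp_mem : ∀ {X Y Z : Obj} (f : X ⟶ Y) (g : Y ⟶ Z), W f → W g → W (f ≫ g)

namespace RelativeCat

attribute [instance] RelativeCat.cat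

/-- Relative functors: the weak equivalence preserving functors. -/
@[ext]
structure RelFunctor (X : RelativeCat.{v, u}) (Y : RelativeCat.{v', u'}) where
  /-- the underlying functor -/
  toFunctor : X.Obj ⥤ Y.Obj
  map_mem : ∀ {a b : X.Obj} (f : a ⟶ b), X.W f → Y.W (toFunctor.map f)

/-- The identity relative functor. -/
def RelFunctor.id (X : RelativeCat.{v, u}) : RelFunctor X X where
  toFunctor := 𝟭 _
  map_mem _ h := h

/-- Composition of relative functors. -/
def RelFunctor.comp {X : RelativeCat.{v, u}} {Y : RelativeCat.{v', u'}}
    {Z : RelativeCat.{v'', u''}} (F : RelFunctor X Y) (G : RelFunctor Y Z) : RelFunctor X Z where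
  toFunctor := F.toFunctor ⋙ G.toFunctor
  map_mem f h := G.map_mem _ (F.map_mem f h)

/-- The category of small relative categories and relative functors. -/
instance : Category RelativeCat.{u, u} where
  Hom X Y := RelFunctor X Y
  id X := RelFunctor.id X
  comp F G := RelFunctor.comp F G

/-- The product of two relative categories: a map is a weak equivalence if and only if both of
its components are. -/
def prod (X : RelativeCat.{v, u}) (Y : RelativeCat.{v', u'}) :
    RelativeCat.{max v v', max u u'} where
  Obj := X.Obj × Y.Obj
  cat := CategoryTheory.prod' X.Obj Y.Obj
  W := X.W.prod Y.W
  id_mem _ := ⟨X.id_mem _, Y.id_mem _⟩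
  comp_mem _ _ hf hg := ⟨X.comp_mem _ _ hf.1 hg.1, Y.comp_mem _ _ hf.2 hg.2⟩

/-- The product of two relative functors. -/
def RelFunctor.prod {X X' : RelativeCat.{v, u}} {Y Y' : RelativeCat.{v', u'}}
    (F : RelFunctor X X') (G : RelFunctor Y Y') : RelFunctor (X.prod Y) (X'.prod Y') where
  toFunctor := CategoryTheory.Functor.prod F.toFunctor G.toFunctor
  map_mem _ h := ⟨F.map_mem _ h.1, G.map_mem _ h.2⟩

/-- The relative category `p̂`: the category `0 → ⋯ → p` in which only the identity maps are
weak equivalences. -/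
def hat (p : SimplexCategory) : RelativeCat.{0, 0} where
  Obj := Fin (p.len + 1)
  W i j _ := i = j
  id_mem _ := rfl
  comp_mem _ _ hf hg := hf.trans hg

/-- The relative category `q̌`: the category `0 → ⋯ → q` in which all maps are weak
equivalences. -/
def check (q : SimplexCategory) : RelativeCat.{0, 0} where
  Obj := Fin (q.len + 1)
  W _ _ _ := True
  id_mem _ := trivial
  comp_mem _ _ _ _ := trivial

/-- The relative functor between the relative categories `p̂` induced by a monotone map. -/
def hatMap {p p' : SimplexCategory} (s : p ⟶ p') : RelFunctor (hat p) (hat p') where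
  toFunctor := s.toOrderHom.monotone.functor
  map_mem {_ _} _ h := congrArg s.toOrderHom h

/-- The relative functor between the relative categories `q̌` induced by a monotone map. -/
def checkMap {q q' : SimplexCategory} (s : q ⟶ q') : RelFunctor (check q) (check q') where
  toFunctor := s.toOrderHom.monotone.functor
  map_mem _ _ := trivial

end RelativeCat

/-! ### Simplicial spaces -/

/-- The category `sS` of simplicial spaces, i.e. of bisimplicial sets. The simplicial set
`X.obj (op p)` is the space in dimension `p`, and its `q`-simplices are the
`(p, q)`-bisimplices of `X`. -/
abbrev SimplicialSpace : Type (u + 1) := SimplexCategoryᵒᵖ ⥤ SSet.{u}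

open RelativeCat in
/-- The simplicial nerve of a relative category `X`: its `(p, q)`-bisimplices are the relative
functors `p̂ × q̌ ⟶ X`. -/
def simplicialNerveObj (X : RelativeCat.{u, u}) : SimplicialSpace.{u} where
  obj p :=
    { obj := fun q => RelFunctor ((hat p.unop).prod (check q.unop)) X
      map := fun t => ↾fun x => ((RelFunctor.id _).prod (checkMap t.unop)).comp x
      map_id := fun _ => rfl
      map_comp := fun _ _ => rfl }
  map s := { app := fun _ => ↾fun x => ((hatMap s.unop).prod (RelFunctor.id _)).comp x }

open RelativeCat in
/-- The simplicial nerve functor `N` from relative categories to simplicial spaces. -/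
def simplicialNerve : RelativeCat.{u, u} ⥤ SimplicialSpace.{u} where
  obj X := simplicialNerveObj X
  map {X Y} F :=
    { app := fun _ => { app := fun _ => ↾fun x => RelFunctor.comp (Z := Y) x F } }

/-! ### The relativization functor -/

/-- The objects of the Grothendieck construction `bA` of the simplicial category `A`: the pairs
of a dimension `p ≥ 0` and an object of `A`. -/
structure BObj (A : SCat.{u}) : Type u where
  /-- the dimension -/
  dim : SimplexCategoryᵒᵖ
  /-- the object of `A` -/
  obj : A.Obj

/-- The maps `(p₁, A₁) ⟶ (p₂, A₂)` of `bA`: the pairs of a simplicial operator `t` from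
dimension `p₁` to dimension `p₂` and a map `A₁ ⟶ A₂` of `A_{p₂}`. -/
@[ext]
structure BHom {A : SCat.{u}} (X Y : BObj A) : Type u where
  /-- the simplicial operator -/
  op : X.dim ⟶ Y.dim
  /-- the map in `A_{p₂}` -/
  map : (A.hom X.obj Y.obj).obj Y.dim

/-- The map `a` of a map `(t, a)` of `bA`, as a map of the category `A_{p₂}`. -/
abbrev BHom.levelHom {A : SCat.{u}} {X Y : BObj A} (f : BHom X Y) :
    SCat.Level.mk (p := Y.dim) X.obj ⟶ SCat.Level.mk Y.obj := f.map

/-- The map `(t, id)` of `bA` given by a simplicial operator `t` and an object of `A`. -/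
def BHom.ofOperator {A : SCat.{u}} {p q : SimplexCategoryᵒᵖ} (t : p ⟶ q) (a : A.Obj) :
    BHom (A := A) ⟨p, a⟩ ⟨q, a⟩ :=
  ⟨t, 𝟙 (SCat.Level.mk a)⟩

/-- The category `bA`, with composition `(t', a') (t, a) = (t' t, a' (t' a))`, where `t' a` is the
image of the map `a` of `A_{p₂}` under the simplicial operator `t'`. -/
instance (A : SCat.{u}) : Category.{u} (BObj A) where
  Hom X Y := BHom X Y
  id X := BHom.ofOperator (𝟙 X.dim) X.obj
  comp f g := ⟨f.op ≫ g.op, (A.levelMap g.op).map f.levelHom ≫ g.levelHom⟩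
  id_comp {X Y} f := by
    refine BHom.ext (Category.id_comp _) ?_
    exact (congrArg (· ≫ f.levelHom) ((A.levelMap f.op).map_id _)).trans (Category.id_comp _)
  comp_id {X Y} f := by
    refine BHom.ext (Category.comp_id _) ?_
    exact (Category.comp_id _).trans
      (ConcreteCategory.congr_hom ((A.hom X.obj Y.obj).map_id Y.dim) f.map)
  assoc {X Y Z T} f g h := by
    refine BHom.ext (Category.assoc _ _ _) ?_
    have e₁ : (A.levelMap (g.op ≫ h.op)).map f.levelHom =
        (A.levelMap h.op).map ((A.levelMap g.op).map f.levelHom) :=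
      ConcreteCategory.congr_hom ((A.hom X.obj Y.obj).map_comp g.op h.op) f.map
    have e₂ := (A.levelMap h.op).map_comp ((A.levelMap g.op).map f.levelHom) g.levelHom
    refine (congrArg (· ≫ h.levelHom) e₂).trans ((Category.assoc _ _ _).trans ?_)
    exact congrArg (· ≫ (A.levelMap h.op).map g.levelHom ≫ h.levelHom) e₁.symm

/-- The maps of `bA` of the form `(t, id)`. -/
inductive BIdentity (A : SCat.{u}) : MorphismProperty (BObj A)
  | mk {p q : SimplexCategoryᵒᵖ} (t : p ⟶ q) (a : A.Obj) :
      BIdentity A (BHom.ofOperator t a)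

/-- The relativization of a simplicial category `A`: the category `bA`, in which the weak
equivalences are the maps of the form `(t, id)`. -/
def relativizationObj (A : SCat.{u}) : RelativeCat.{u, u} where
  Obj := BObj A
  W := BIdentity A
  id_mem X := BIdentity.mk (𝟙 X.dim) X.obj
  comp_mem {X Y Z} f g hf hg := by
    obtain @⟨p, q, t, a⟩ := hf
    obtain ⟨_, hZ, h⟩ : ∃ (r : SimplexCategoryᵒᵖ) (hZ : Z = ⟨r, a⟩) (t' : q ⟶ r),
        g ≫ eqToHom hZ = BHom.ofOperator t' a := by
      obtain @⟨_, r, t', _⟩ := hg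
      exact ⟨r, rfl, t', Category.comp_id _⟩
    subst hZ
    obtain ⟨t', h⟩ := h
    obtain rfl : g = BHom.ofOperator t' a := (Category.comp_id g).symm.trans h
    have e : (BHom.ofOperator t a ≫ BHom.ofOperator t' a :
        (⟨p, a⟩ : BObj A) ⟶ ⟨_, a⟩) = BHom.ofOperator (t ≫ t') a :=
      BHom.ext rfl ((Category.comp_id _).trans ((A.levelMap t').map_id _))
    exact e ▸ BIdentity.mk (t ≫ t') a

/-- The functor `bA ⥤ bB` induced by a simplicial functor `A ⟶ B`. -/
def bFunctor {A B : SCat.{u}} (F : A ⟶ B) : BObj A ⥤ BObj B where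
  obj X := ⟨X.dim, EnrichedFunctor.obj F X.obj⟩
  map {X Y} := fun (f : BHom X Y) =>
    show BHom _ _ from ⟨f.op, (SCat.levelFunctor F Y.dim).map f.levelHom⟩
  map_id X := BHom.ext rfl ((SCat.levelFunctor F X.dim).map_id _)
  map_comp {X Y Z} f g := by
    refine BHom.ext rfl ?_
    refine ((SCat.levelFunctor F Z.dim).map_comp _ _).trans ?_
    exact congrArg (· ≫ (SCat.levelFunctor F Z.dim).map (BHom.levelHom g))
      (NatTrans.naturality_apply (EnrichedFunctor.map F X.obj Y.obj) (BHom.op g) (BHom.map f))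

/-- The relativization functor `Rel` from simplicial categories to relative categories. -/
def relativization : SCat.{u} ⥤ RelativeCat.{u, u} where
  obj A := relativizationObj A
  map {A B} F :=
    { toFunctor := bFunctor F
      map_mem := by
        rintro _ _ _ ⟨t, a⟩
        have e : (bFunctor F).map (X := ⟨_, a⟩) (Y := ⟨_, a⟩) (BHom.ofOperator t a) =
            (show BHom _ _ from BHom.ofOperator t (EnrichedFunctor.obj F a)) :=
          BHom.ext (A := B) rfl ((SCat.levelFunctor F _).map_id _)
        exact e ▸ BIdentity.mk t (EnrichedFunctor.obj F a) }
  map_id A := rfl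
  map_comp F G := rfl

/-! ### The flipped nerve functor -/

/-- The flipped nerve functor `Z` from simplicial categories to simplicial spaces. The
`q`-simplices of the space of `Z A` in dimension `k` are the sequences of `k` composable maps of
the category `A_q`, i.e. (see `flippedNerveEquiv`) the elements of the disjoint union, over the
sequences `A₀, …, A_k` of objects, of the sets of `q`-simplices of
`hom(A₀, A₁) × ⋯ × hom(A_{k-1}, A_k)`. -/
def flippedNerve : SCat.{u} ⥤ SimplicialSpace.{u} :=
  SCat.diagramFunctor ⋙ (Functor.whiskeringRight _ _ _).obj nerveFunctor.{u, u} ⋙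
    flipFunctor _ _ _

/-- The simplices of the flipped nerve, described through the disjoint union, taken over all
sequences `A₀, …, A_k` of objects, of the products `hom(A₀, A₁) × ⋯ × hom(A_{k-1}, A_k)`. -/
noncomputable def flippedNerveEquiv (A : SCat.{u}) (k q : ℕ) :
    ((flippedNerve.obj A).obj (op (.mk k))).obj (op (.mk q)) ≃
      Σ a : Fin (k + 1) → A.Obj,
        ∀ i : Fin k, (A.hom (a i.castSucc) (a i.succ)).obj (op (.mk q)) where
  toFun := fun (x : ComposableArrows (A.Level (op (.mk q))) k) =>
    ⟨fun i => (x.obj i).obj, fun i => x.map (homOfLE i.castSucc_le_succ)⟩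
  invFun y := ComposableArrows.mkOfObjOfMapSucc
    (fun i => (SCat.Level.mk (y.1 i) : A.Level (op (.mk q)))) y.2
  left_inv := fun (x : ComposableArrows (A.Level (op (.mk q))) k) => by
    refine ComposableArrows.ext (fun _ => rfl) (fun i hi => ?_)
    refine (ComposableArrows.mkOfObjOfMapSucc_map_succ _ _ i hi).trans ?_
    exact ((Category.id_comp _).trans (Category.comp_id _)).symm
  right_inv y := by
    refine Sigma.ext rfl (heq_of_eq (funext fun i => ?_))
    exact ComposableArrows.mkOfObjOfMapSucc_map_succ _ _ i.1 i.2

/-! ### Weak equivalences -/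

/-- The set `[X, K]` of homotopy classes of maps from `X` to `K`: the quotient of the set of maps
by the equivalence relation generated by simplicial homotopies. -/
def HomotopyClasses (X K : SSet.{u}) : Type u :=
  Quot fun f g : X ⟶ K => Nonempty (SSet.Homotopy f g)

/-- The map `[Y, K] → [X, K]` induced by a map `f : X ⟶ Y`. -/
def HomotopyClasses.precomp {X Y : SSet.{u}} (f : X ⟶ Y) (K : SSet.{u}) :
    HomotopyClasses Y K → HomotopyClasses X K :=
  Quot.map (fun g => f ≫ g) fun _ _ ⟨H⟩ =>
    ⟨{ h := f ▷ _ ≫ H.h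
       h₀ := congrArg (f ≫ ·) H.h₀
       h₁ := congrArg (f ≫ ·) H.h₁
       rel := by ext _ ⟨x, _⟩; exact x.2.elim }⟩

/-- Weak (homotopy) equivalences of simplicial sets: the maps `f : X ⟶ Y` that induce a bijection
`[Y, K] → [X, K]` on homotopy classes of maps to every Kan complex `K`. -/
def IsWeakEquivalence {X Y : SSet.{u}} (f : X ⟶ Y) : Prop :=
  ∀ K : SSet.{u}, SSet.KanComplex K → Function.Bijective (HomotopyClasses.precomp f K)

/-- Reedy equivalences of simplicial spaces: the maps that are weak equivalences of simplicial
sets in every dimension. -/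
def IsReedyEquivalence {X Y : SimplicialSpace.{u}} (f : X ⟶ Y) : Prop :=
  ∀ p : SimplexCategoryᵒᵖ, IsWeakEquivalence (f.app p)

/-- Two functors to simplicial spaces are naturally Reedy equivalent if they can be connected by a
finite zigzag of natural transformations all of whose components are Reedy equivalences. -/
def NaturallyReedyEquivalent {C : Type u'} [Category.{v'} C] (F G : C ⥤ SimplicialSpace.{u}) :
    Prop :=
  Relation.EqvGen
    (fun F' G' : C ⥤ SimplicialSpace.{u} => ∃ α : F' ⟶ G', ∀ c, IsReedyEquivalence (α.app c)) F G

/-! Both functors are compared with a third one, whose value on `A` in dimension `k` is the nerve of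
the category of elements (`elementsNerve`) of the simplicial set `Z A` in dimension `k`. A
`q`-simplex there is a chain of operators `p₀ → ⋯ → p_q` together with a string of `k` maps of
`A_{p₀}`. Transporting the string along the chain fills a `k × q` grid in `bA`, which is a bisimplex
of `N (Rel A)`; this is `gridMap`. In an arbitrary relative functor `k̂ × q̌ → bA` the maps in the
`q`-direction have the form `(t, id)`, so it fails to be such a grid only because the dimensions may
also vary in the `k`-direction. Pushing everything forward to the dimensions of the last column
repairs this, and the weak equivalences `(t, id)` that do the pushing form a simplicial homotopy.
Hence `gridMap` includes a deformation retract (`isWeakEquivalence_gridMap`).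

The other leg is the first vertex map from the nerve of the category of elements of `X` to `X`
(`IsWeakEquivalence.firstVertexMap`). For `X = Δ[n]` both sides contract to a vertex. The simplices
of `elementsNerve.obj X` are, in each dimension, a sum of sets of simplices of `X`, so the functor
behaves as a left adjoint and the general case follows by induction over cells. The induction is run
on the inclusion of the source in the mapping cylinder of the first vertex map: it is shown to be
anodyne (`anodyne_source`), and anodyne extensions induce bijections on homotopy classes of maps to
Kan complexes. -/

namespace SSet

open Simplicial HomotopicalAlgebra modelCategoryQuillen Limits CartesianMonoidalCategory

/-! ### Homotopy extension and lifting; closure properties of anodyne extensions -/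

lemma hom_ext_app {X Y : SSet.{u}} {f g : X ⟶ Y} (h : ∀ q (x : X.obj q), f.app q x = g.app q x) :
    f = g := by
  ext q x
  exact h q x

/-- The value at the first vertex of a simplex of `Δ[1]`. -/
def firstVertex {q : SimplexCategoryᵒᵖ} (φ : Δ[1].obj q) : Fin 2 :=
  (stdSimplex.objEquiv φ).toOrderHom 0

lemma ι₀_app {X : SSet.{u}} {q : SimplexCategoryᵒᵖ} (x : X.obj q) (φ : Δ[1].obj q)
    (h : ∀ k, (stdSimplex.objEquiv φ).toOrderHom k = 0) :
    ι₀.app q x = (x, φ) := by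
  refine Prod.ext rfl (stdSimplex.objEquiv.injective ?_)
  ext k : 3
  exact (h k).symm

lemma ι₁_app {X : SSet.{u}} {q : SimplexCategoryᵒᵖ} (x : X.obj q) (φ : Δ[1].obj q)
    (h : firstVertex φ = 1) :
    ι₁.app q x = (x, φ) := by
  refine Prod.ext rfl (stdSimplex.objEquiv.injective ?_)
  ext k : 3
  have := (stdSimplex.objEquiv φ).toOrderHom.monotone (Fin.zero_le k)
  change 1 = _
  change (stdSimplex.objEquiv φ).toOrderHom 0 = 1 at h
  rw [h] at this
  exact (le_antisymm (Fin.le_last _) this).symm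

/-- The pushout-product of a monomorphism and an anodyne extension is anodyne. The form without the
pushout is applied with `j` a horn of `Δ[1]` (first alternative) to extend homotopies, and with `j`
the boundary of `Δ[1]` (second alternative) to extend homotopies with both ends prescribed. -/
lemma exists_lift_of_mono_of_anodyne {X₁ Y₁ X₂ Y₂ E B : SSet.{u}} (i : X₁ ⟶ Y₁) (j : X₂ ⟶ Y₂)
    (p : E ⟶ B) [Fibration p]
    (hij : (Mono i ∧ anodyneExtensions j) ∨ (anodyneExtensions i ∧ Mono j))
    (f : Y₁ ⊗ X₂ ⟶ E) (g : X₁ ⊗ Y₂ ⟶ E) (b : Y₁ ⊗ Y₂ ⟶ B)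
    (hfg : i ▷ X₂ ≫ f = X₁ ◁ j ≫ g) (hf : f ≫ p = Y₁ ◁ j ≫ b) (hg : g ≫ p = i ▷ Y₂ ≫ b) :
    ∃ l : Y₁ ⊗ Y₂ ⟶ E, Y₁ ◁ j ≫ l = f ∧ i ▷ Y₂ ≫ l = g ∧ l ≫ p = b := by
  let sq := Functor.PushoutObjObj.ofHasPushout (curriedTensor SSet.{u}) i j
  have h : anodyneExtensions sq.ι := by
    rcases hij with ⟨_, h⟩ | ⟨h, _⟩
    · exact anodyneExtensions_pushoutObjObjι _ h
    · exact anodyneExtensions_pushoutObjObjι' _ h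
  have := h p (by rwa [← HomotopicalAlgebra.fibration_iff])
  have sq' : CommSq (sq.isPushout.desc f g hfg) sq.ι p b := ⟨by
    apply sq.isPushout.hom_ext
    · rw [sq.isPushout.inl_desc_assoc, sq.inl_ι_assoc]; exact hf
    · rw [sq.isPushout.inr_desc_assoc, sq.inr_ι_assoc]; exact hg⟩
  refine ⟨sq'.lift, ?_, ?_, sq'.fac_right⟩
  · have := sq.inl ≫= sq'.fac_left
    rwa [sq.inl_ι_assoc, sq.isPushout.inl_desc] at this
  · have := sq.inr ≫= sq'.fac_left
    rwa [sq.inr_ι_assoc, sq.isPushout.inr_desc] at this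

/-- An operator that takes the value `1` has, together with the vertex `0`, all of `{0, 1}` as
range. So this horn is the vertex `0`, and `X ⊗ Λ[1, 0]` is the end `ι₀` of the cylinder. -/
lemma eq_zero_of_mem_horn {q : SimplexCategoryᵒᵖ} (φ : (Λ[1, 0] : SSet.{u}).obj q) (k) :
    (stdSimplex.objEquiv φ.1).toOrderHom k = 0 := by
  by_contra h
  have h' : (stdSimplex.objEquiv φ.1).toOrderHom k = 1 := Fin.eq_one_of_ne_zero _ h
  refine φ.2 (Set.eq_univ_of_forall fun m => ?_)
  fin_cases m
  · exact Or.inr rfl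
  · exact Or.inl ⟨k, h'⟩

lemma eq_one_of_mem_horn {q : SimplexCategoryᵒᵖ} (φ : (Λ[1, 1] : SSet.{u}).obj q) (k) :
    (stdSimplex.objEquiv φ.1).toOrderHom k = 1 := by
  by_contra h
  have h' : (stdSimplex.objEquiv φ.1).toOrderHom k = 0 := by
    generalize (stdSimplex.objEquiv φ.1).toOrderHom k = a at h
    change Fin 2 at a
    fin_cases a
    · rfl
    · exact absurd rfl h
  refine φ.2 (Set.eq_univ_of_forall fun m => ?_)
  fin_cases m
  · exact Or.inl ⟨k, h'⟩
  · exact Or.inr rfl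

lemma whiskerLeft_horn_zero_ι (X : SSet.{u}) :
    X ◁ (Λ[1, 0] : Δ[1].Subcomplex).ι = fst _ _ ≫ ι₀ := by
  refine hom_ext_app fun q ⟨x, φ⟩ => ?_
  exact (ι₀_app x φ.1 (eq_zero_of_mem_horn φ)).symm

lemma whiskerLeft_horn_one_ι (X : SSet.{u}) :
    X ◁ (Λ[1, 1] : Δ[1].Subcomplex).ι = fst _ _ ≫ ι₁ := by
  refine hom_ext_app fun q ⟨x, φ⟩ => ?_
  exact (ι₁_app x φ.1 (eq_one_of_mem_horn φ 0)).symm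

instance (X : SSet.{u}) (i : Fin 2) : Epi (fst X (Λ[1, i] : SSet.{u})) := by
  have h : stdSimplex.obj₀Equiv.symm i ∈ (Λ[1, i] : Δ[1].Subcomplex).obj (op ⦋0⦌) := by
    intro h
    obtain ⟨k, hk⟩ | hk := (Set.eq_univ_iff_forall.1 h) (1 - i)
    · change i = 1 - i at hk
      fin_cases i <;> simp at hk
    · change 1 - i = i at hk
      fin_cases i <;> simp at hk
  -- The vertex `i` of the horn gives a section of the projection.
  have : lift (𝟙 X) (SSet.const (Y := Λ[1, i]) ⟨_, h⟩) ≫ fst X (Λ[1, i] : SSet.{u}) = 𝟙 X :=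
    lift_fst _ _
  exact epi_of_epi_fac this

/-- The homotopy extension and lifting property, for a homotopy starting at a given map. -/
lemma exists_homotopy_extension_zero {A X E B : SSet.{u}} (i : A ⟶ X) [Mono i] (p : E ⟶ B)
    [Fibration p] (f : X ⟶ E) (h : A ⊗ Δ[1] ⟶ E) (b : X ⊗ Δ[1] ⟶ B)
    (hf : i ≫ f = ι₀ ≫ h) (hfb : f ≫ p = ι₀ ≫ b) (hb : h ≫ p = i ▷ _ ≫ b) :
    ∃ l : X ⊗ Δ[1] ⟶ E, ι₀ ≫ l = f ∧ i ▷ _ ≫ l = h ∧ l ≫ p = b := by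
  obtain ⟨l, h₁, h₂, h₃⟩ := exists_lift_of_mono_of_anodyne i (Λ[1, 0] : Δ[1].Subcomplex).ι p
    (Or.inl ⟨inferInstance, anodyneExtensions.horn_ι 0⟩) (fst _ _ ≫ f) h b
    (by rw [whiskerLeft_horn_zero_ι, Category.assoc, ← hf]; rfl)
    (by rw [whiskerLeft_horn_zero_ι, Category.assoc, Category.assoc, ← hfb])
    hb
  refine ⟨l, ?_, h₂, h₃⟩
  rwa [whiskerLeft_horn_zero_ι, Category.assoc, cancel_epi] at h₁

lemma exists_homotopy_extension_one {A X E B : SSet.{u}} (i : A ⟶ X) [Mono i] (p : E ⟶ B)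
    [Fibration p] (f : X ⟶ E) (h : A ⊗ Δ[1] ⟶ E) (b : X ⊗ Δ[1] ⟶ B)
    (hf : i ≫ f = ι₁ ≫ h) (hfb : f ≫ p = ι₁ ≫ b) (hb : h ≫ p = i ▷ _ ≫ b) :
    ∃ l : X ⊗ Δ[1] ⟶ E, ι₁ ≫ l = f ∧ i ▷ _ ≫ l = h ∧ l ≫ p = b := by
  obtain ⟨l, h₁, h₂, h₃⟩ := exists_lift_of_mono_of_anodyne i (Λ[1, 1] : Δ[1].Subcomplex).ι p
    (Or.inl ⟨inferInstance, anodyneExtensions.horn_ι 1⟩) (fst _ _ ≫ f) h b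
    (by rw [whiskerLeft_horn_one_ι, Category.assoc, ← hf]; rfl)
    (by rw [whiskerLeft_horn_one_ι, Category.assoc, Category.assoc, ← hfb])
    hb
  refine ⟨l, ?_, h₂, h₃⟩
  rwa [whiskerLeft_horn_one_ι, Category.assoc, cancel_epi] at h₁

/-- A simplex of the boundary of `Δ[1]` is not surjective on vertices, hence constant. This makes
the case distinction on `firstVertex` in `descBoundary` compatible with operators. -/
lemma eq_firstVertex_of_mem_boundary {q : SimplexCategoryᵒᵖ} (φ : (∂Δ[1] : SSet.{u}).obj q) (k) :
    (stdSimplex.objEquiv φ.1).toOrderHom k = firstVertex φ.1 := by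
  by_contra h
  refine φ.2 fun m => ?_
  by_cases hm : m = firstVertex φ.1
  · exact ⟨0, hm.symm⟩
  · refine ⟨k, ?_⟩
    change (stdSimplex.objEquiv φ.1).toOrderHom k = m
    generalize (stdSimplex.objEquiv φ.1).toOrderHom k = a at h ⊢
    generalize firstVertex φ.1 = c at *
    change Fin 2 at a m
    revert a m c
    decide

/-- The map `X ⊗ ∂Δ[1] ⟶ E` given by two maps `X ⟶ E`. -/
def descBoundary {X E : SSet.{u}} (f g : X ⟶ E) : X ⊗ (∂Δ[1] : SSet.{u}) ⟶ E where
  app q := ↾fun y => if firstVertex y.2.1 = 0 then f.app q y.1 else g.app q y.1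
  naturality p q t := by
    ext ⟨x, φ⟩
    have e : firstVertex (Δ[1].map t φ.1) = firstVertex φ.1 :=
      eq_firstVertex_of_mem_boundary φ (t.unop.toOrderHom 0)
    change (if firstVertex (Δ[1].map t φ.1) = 0 then f.app q (X.map t x) else g.app q (X.map t x)) =
      E.map t (if firstVertex φ.1 = 0 then f.app p x else g.app p x)
    rw [e, NatTrans.naturality_apply, NatTrans.naturality_apply]
    split_ifs <;> rfl

lemma comp_descBoundary_ext {X E : SSet.{u}} {f g : X ⟶ E} {h : X ⊗ Δ[1] ⟶ E}
    (h₀ : ι₀ ≫ h = f) (h₁ : ι₁ ≫ h = g) :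
    X ◁ (∂Δ[1] : Δ[1].Subcomplex).ι ≫ h = descBoundary f g := by
  subst h₀ h₁
  refine hom_ext_app fun q ⟨x, φ⟩ => ?_
  change h.app q (x, φ.1) =
    if firstVertex φ.1 = 0 then h.app q (ι₀.app q x) else h.app q (ι₁.app q x)
  split_ifs with hφ
  · rw [ι₀_app x φ.1 (fun k => (eq_firstVertex_of_mem_boundary φ k).trans hφ)]
  · rw [ι₁_app x φ.1 (Fin.eq_one_of_ne_zero _ hφ)]

lemma ι₀_snd_mem_boundary {X : SSet.{u}} {q : SimplexCategoryᵒᵖ} (x : X.obj q) :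
    (ι₀.app q x).2 ∈ (∂Δ[1] : Δ[1].Subcomplex).obj q := by
  intro h
  obtain ⟨k, hk⟩ := h 1
  change (0 : Fin 2) = 1 at hk
  simp at hk

lemma ι₁_snd_mem_boundary {X : SSet.{u}} {q : SimplexCategoryᵒᵖ} (x : X.obj q) :
    (ι₁.app q x).2 ∈ (∂Δ[1] : Δ[1].Subcomplex).obj q := by
  intro h
  obtain ⟨k, hk⟩ := h 0
  change (1 : Fin 2) = 0 at hk
  simp at hk

lemma ι₀_comp_eq_of_comp_eq_descBoundary {X E : SSet.{u}} {f g : X ⟶ E} {h : X ⊗ Δ[1] ⟶ E}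
    (w : X ◁ (∂Δ[1] : Δ[1].Subcomplex).ι ≫ h = descBoundary f g) : ι₀ ≫ h = f :=
  hom_ext_app fun q x => by
    let y : (X ⊗ (∂Δ[1] : SSet.{u})).obj q := (x, ⟨_, ι₀_snd_mem_boundary x⟩)
    exact ConcreteCategory.congr_hom (NatTrans.congr_app w q) y

lemma ι₁_comp_eq_of_comp_eq_descBoundary {X E : SSet.{u}} {f g : X ⟶ E} {h : X ⊗ Δ[1] ⟶ E}
    (w : X ◁ (∂Δ[1] : Δ[1].Subcomplex).ι ≫ h = descBoundary f g) : ι₁ ≫ h = g :=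
  hom_ext_app fun q x => by
    let y : (X ⊗ (∂Δ[1] : SSet.{u})).obj q := (x, ⟨_, ι₁_snd_mem_boundary x⟩)
    exact ConcreteCategory.congr_hom (NatTrans.congr_app w q) y

lemma descBoundary_comp {X E E' : SSet.{u}} (f g : X ⟶ E) (p : E ⟶ E') :
    descBoundary f g ≫ p = descBoundary (f ≫ p) (g ≫ p) := by
  refine hom_ext_app fun q ⟨x, φ⟩ => ?_
  exact apply_ite (p.app q) _ _ _

lemma comp_descBoundary {X' X E : SSet.{u}} (i : X' ⟶ X) (f g : X ⟶ E) :
    i ▷ _ ≫ descBoundary f g = descBoundary (i ≫ f) (i ≫ g) := rfl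

/-- Homotopies with prescribed ends extend along anodyne extensions. -/
lemma exists_homotopy_extension_of_anodyne {A X E B : SSet.{u}} {i : A ⟶ X}
    (hi : anodyneExtensions i) (p : E ⟶ B) [Fibration p] (f g : X ⟶ E) (h : A ⊗ Δ[1] ⟶ E)
    (b : X ⊗ Δ[1] ⟶ B) (hf : ι₀ ≫ h = i ≫ f) (hg : ι₁ ≫ h = i ≫ g) (hfb : ι₀ ≫ b = f ≫ p)
    (hgb : ι₁ ≫ b = g ≫ p) (hb : h ≫ p = i ▷ _ ≫ b) :
    ∃ l : X ⊗ Δ[1] ⟶ E, ι₀ ≫ l = f ∧ ι₁ ≫ l = g ∧ i ▷ _ ≫ l = h ∧ l ≫ p = b := by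
  obtain ⟨l, h₁, h₂, h₃⟩ := exists_lift_of_mono_of_anodyne i (∂Δ[1] : Δ[1].Subcomplex).ι p
    (Or.inr ⟨hi, inferInstance⟩) (descBoundary f g) h b
    (by rw [comp_descBoundary, comp_descBoundary_ext hf hg])
    (by rw [descBoundary_comp, comp_descBoundary_ext hfb hgb]) hb
  exact ⟨l, ι₀_comp_eq_of_comp_eq_descBoundary h₁, ι₁_comp_eq_of_comp_eq_descBoundary h₁, h₂, h₃⟩

lemma anodyneExtensions.exists_lift {A X E B : SSet.{u}} {i : A ⟶ X} (hi : anodyneExtensions i)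
    (p : E ⟶ B) [Fibration p] (f : A ⟶ E) (b : X ⟶ B) (w : f ≫ p = i ≫ b) :
    ∃ l : X ⟶ E, i ≫ l = f ∧ l ≫ p = b := by
  have := hi p (by rwa [← HomotopicalAlgebra.fibration_iff])
  have sq : CommSq f i p b := ⟨w⟩
  exact ⟨sq.lift, sq.fac_left, sq.fac_right⟩

lemma anodyneExtensions.of_exists_lift {A X : SSet.{u}} {i : A ⟶ X}
    (hi : ∀ ⦃E B : SSet.{u}⦄ (p : E ⟶ B) [Fibration p] (f : A ⟶ E) (b : X ⟶ B),
      f ≫ p = i ≫ b → ∃ l : X ⟶ E, i ≫ l = f ∧ l ≫ p = b) :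
    anodyneExtensions i := by
  intro E B p hp
  rw [← HomotopicalAlgebra.fibration_iff] at hp
  refine ⟨fun {f b} sq => ?_⟩
  obtain ⟨l, h₁, h₂⟩ := hi p f b sq.w
  exact ⟨⟨l, h₁, h₂⟩⟩

/-- Anodyne extensions have the right cancellation property among monomorphisms. -/
lemma anodyneExtensions.of_comp {A X Y : SSet.{u}} {i : A ⟶ X} {j : X ⟶ Y} [Mono j]
    (hi : anodyneExtensions i) (hij : anodyneExtensions (i ≫ j)) : anodyneExtensions j := by
  refine .of_exists_lift fun E B p _ f b w => ?_
  obtain ⟨l, h₁, h₂⟩ := hij.exists_lift p (i ≫ f) b (by rw [Category.assoc, w, Category.assoc])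
  -- The lift `l` is only correct on `A`. But `j ≫ l` and `f` agree on `A` and lie over the same map
  -- to `B`, so they are homotopic relative to `A` and over `B`; extending this homotopy along `j`
  -- from `l` moves `l` to a genuine solution.
  obtain ⟨h, k₀, k₁, -, k₃⟩ := exists_homotopy_extension_of_anodyne hi p (j ≫ l) f
    (fst _ _ ≫ i ≫ f) (fst _ _ ≫ j ≫ b)
    (by rw [ι₀_fst_assoc, ← h₁, Category.assoc]) (by rw [ι₁_fst_assoc])
    (by rw [ι₀_fst_assoc, Category.assoc, h₂]) (by rw [ι₁_fst_assoc, w])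
    (by rw [Category.assoc, Category.assoc, w, whiskerRight_fst_assoc])
  obtain ⟨l', m₀, m₁, m₂⟩ := exists_homotopy_extension_zero j p l h (fst _ _ ≫ b) k₀.symm
    (by rw [ι₀_fst_assoc, h₂]) (by rw [k₃, whiskerRight_fst_assoc])
  refine ⟨ι₁ ≫ l', ?_, ?_⟩
  · rw [← ι₁_comp_assoc, m₁, k₁]
  · rw [Category.assoc, m₂, ι₁_fst_assoc]

/-- The inclusion of a strong deformation retract is an anodyne extension. -/
lemma anodyneExtensions.of_deformation {Y X : SSet.{u}} (f : Y ⟶ X) [Mono f] (r : X ⟶ Y)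
    (h : X ⊗ Δ[1] ⟶ X) (h₀ : ι₀ ≫ h = r ≫ f) (h₁ : ι₁ ≫ h = 𝟙 X)
    (hf : f ▷ _ ≫ h = fst _ _ ≫ f) : anodyneExtensions f := by
  refine .of_exists_lift fun E B p _ a b w => ?_
  have e : f ≫ r = 𝟙 Y := by
    rw [← cancel_mono f, Category.assoc, ← h₀, ← ι₀_comp_assoc, hf, ι₀_fst_assoc, Category.id_comp]
  -- The map `r ≫ a` solves the problem for the retracted base map `r ≫ f ≫ b`; lifting the
  -- deformation `h ≫ b`, constantly on `Y`, carries it to a solution over `b`.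
  obtain ⟨l, m₀, m₁, m₂⟩ := exists_homotopy_extension_zero f p (r ≫ a) (fst _ _ ≫ a) (h ≫ b)
    (by rw [reassoc_of% e, ι₀_fst_assoc])
    (by rw [Category.assoc, w, reassoc_of% h₀])
    (by rw [Category.assoc, w, reassoc_of% hf])
  refine ⟨ι₁ ≫ l, ?_, ?_⟩
  · rw [← ι₁_comp_assoc, m₁, ι₁_fst_assoc]
  · rw [Category.assoc, m₂, reassoc_of% h₁]

end SSet

/-! ### Weak equivalences through homotopy classes of maps to Kan complexes -/

namespace SSet

open Simplicial HomotopicalAlgebra modelCategoryQuillen Limits CartesianMonoidalCategory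

/-- A homotopy, given by a map out of the cylinder. -/
def Homotopy.ofHom {X Y : SSet.{u}} {f g : X ⟶ Y} (h : X ⊗ Δ[1] ⟶ Y) (h₀ : ι₀ ≫ h = f)
    (h₁ : ι₁ ≫ h = g) : Homotopy f g where
  h := h
  h₀ := h₀
  h₁ := h₁
  rel := by ext _ ⟨x, _⟩; exact x.2.elim

end SSet

open SSet Simplicial HomotopicalAlgebra CartesianMonoidalCategory

lemma HomotopyClasses.precomp_comp {X Y Z : SSet.{u}} (f : X ⟶ Y) (g : Y ⟶ Z) (K : SSet.{u}) :
    precomp (f ≫ g) K = precomp f K ∘ precomp g K := by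
  funext x
  induction x using Quot.ind
  exact congrArg (Quot.mk _) (Category.assoc _ _ _)

lemma HomotopyClasses.precomp_eq_of_homotopy {X Y : SSet.{u}} {f g : X ⟶ Y} (h : SSet.Homotopy f g)
    (K : SSet.{u}) : precomp f K = precomp g K := by
  funext x
  induction x using Quot.ind with
  | mk k => exact Quot.sound ⟨.ofHom (h.h ≫ k) (by rw [h.h₀_assoc]) (by rw [h.h₁_assoc])⟩

lemma HomotopyClasses.precomp_id (X K : SSet.{u}) : precomp (𝟙 X) K = id := by
  funext x
  induction x using Quot.ind
  exact congrArg (Quot.mk _) (Category.id_comp _)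

namespace IsWeakEquivalence

variable {X Y Z : SSet.{u}} {f : X ⟶ Y} {g : Y ⟶ Z}

lemma comp (hf : IsWeakEquivalence f) (hg : IsWeakEquivalence g) : IsWeakEquivalence (f ≫ g) :=
  fun K hK => by
    rw [HomotopyClasses.precomp_comp]
    exact (hf K hK).comp (hg K hK)

lemma of_comp_left (hf : IsWeakEquivalence f) (hfg : IsWeakEquivalence (f ≫ g)) :
    IsWeakEquivalence g := fun K hK => by
  have h := hfg K hK
  rw [HomotopyClasses.precomp_comp] at h
  exact (Function.Bijective.of_comp_iff' (hf K hK) _).1 h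

lemma of_homotopyEquivalence (r : Y ⟶ X) (h : SSet.Homotopy (𝟙 Y) (r ≫ f)) (hr : f ≫ r = 𝟙 X) :
    IsWeakEquivalence f := fun K _ => by
  have h₁ := HomotopyClasses.precomp_eq_of_homotopy h K
  have h₂ := congrArg (HomotopyClasses.precomp · K) hr
  rw [HomotopyClasses.precomp_comp, HomotopyClasses.precomp_id] at h₁ h₂
  exact Function.bijective_iff_has_inverse.2 ⟨_, congrFun h₁.symm, congrFun h₂⟩

lemma id (X : SSet.{u}) : IsWeakEquivalence (𝟙 X) := fun K _ => by
  rw [HomotopyClasses.precomp_id]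
  exact Function.bijective_id

/-- Maps to a Kan complex extend along `f`, and so do homotopies with prescribed ends. Thus the
extension is unique up to homotopy, and choosing one inverts precomposition. -/
lemma of_anodyne (hf : anodyneExtensions f) : IsWeakEquivalence f := fun K hK => by
  open modelCategoryQuillen in
  have H (k : X ⟶ K) : ∃ l : Y ⟶ K, f ≫ l = k := by
    obtain ⟨l, h, -⟩ := hf.exists_lift (Limits.terminal.from K) k (Limits.terminal.from Y)
      (by subsingleton)
    exact ⟨l, h⟩
  choose e he using H
  have key (l l' : Y ⟶ K) (h : X ⊗ Δ[1] ⟶ K) (h₀ : ι₀ ≫ h = f ≫ l) (h₁ : ι₁ ≫ h = f ≫ l') :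
      Nonempty (SSet.Homotopy l l') := by
    obtain ⟨m, m₀, m₁, -⟩ := exists_homotopy_extension_of_anodyne hf (Limits.terminal.from K) l l' h
      (Limits.terminal.from _) h₀ h₁ (by subsingleton) (by subsingleton) (by subsingleton)
    exact ⟨.ofHom m m₀ m₁⟩
  let Φ : HomotopyClasses X K → HomotopyClasses Y K := Quot.lift (fun k => Quot.mk _ (e k))
    (fun k k' ⟨h⟩ => Quot.sound (key _ _ h.h (by rw [h.h₀, he]) (by rw [h.h₁, he])))
  refine Function.bijective_iff_has_inverse.2 ⟨Φ, fun x => ?_, fun x => ?_⟩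
  · induction x using Quot.ind with
    | mk l => exact Quot.sound (key _ _ (fst _ _ ≫ f ≫ l) (by rw [ι₀_fst_assoc, he])
        (by rw [ι₁_fst_assoc]))
  · induction x using Quot.ind with
    | mk k => exact congrArg (Quot.mk _) (he k)

end IsWeakEquivalence

/-! ### Functors given by sums of sets of simplices, and their right adjoints -/

namespace SSet

open Simplicial Limits

lemma yonedaEquiv_symm_naturality {X : SSet.{u}} {p q : SimplexCategoryᵒᵖ} (t : p ⟶ q)
    (x : X.obj p) : (yonedaEquiv (n := q.unop)).symm (X.map t x) =
      SSet.stdSimplex.map t.unop ≫ (yonedaEquiv (n := p.unop)).symm x := by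
  refine hom_ext_app fun r φ => ?_
  change X.map (stdSimplex.objEquiv φ).op (X.map t x) = X.map (stdSimplex.objEquiv φ ≫ t.unop).op x
  rw [← Functor.map_comp_apply]
  rfl

/-- The candidate right adjoint of a functor `S` between categories of simplicial sets. -/
abbrev restriction (S : SSet.{u} ⥤ SSet.{u}) (E : SSet.{u}) : SSet.{u} :=
  (stdSimplex.{u} ⋙ S).op ⋙ yoneda.obj E

/-- The functoriality of `restriction` in the simplicial set. -/
abbrev restrictionMap (S : SSet.{u} ⥤ SSet.{u}) {E B : SSet.{u}} (p : E ⟶ B) :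
    restriction S E ⟶ restriction S B :=
  Functor.whiskerLeft _ (yoneda.map p)

/-- The functoriality of `restriction` in the functor. -/
abbrev restrictionTrans {S S' : SSet.{u} ⥤ SSet.{u}} (l : S ⟶ S') (E : SSet.{u}) :
    restriction S' E ⟶ restriction S E :=
  Functor.whiskerRight (NatTrans.op (Functor.whiskerLeft stdSimplex.{u} l)) (yoneda.obj E)

/-- The map to `restriction S E` adjoint to a map from `S.obj X` to `E`. -/
def toRestriction {S : SSet.{u} ⥤ SSet.{u}} {X E : SSet.{u}} (f : S.obj X ⟶ E) :
    X ⟶ restriction S E where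
  app q := ↾fun x => S.map (yonedaEquiv.symm x) ≫ f
  naturality p q t := by
    ext x
    change S.map (yonedaEquiv.symm (X.map t x)) ≫ f =
      S.map (SSet.stdSimplex.map t.unop) ≫ S.map (yonedaEquiv.symm x) ≫ f
    rw [yonedaEquiv_symm_naturality, S.map_comp, Category.assoc]

lemma comp_toRestriction {S : SSet.{u} ⥤ SSet.{u}} {A X E : SSet.{u}} (j : A ⟶ X)
    (f : S.obj X ⟶ E) : j ≫ toRestriction f = toRestriction (S.map j ≫ f) := by
  refine hom_ext_app fun q x => ?_
  change S.map (yonedaEquiv.symm (j.app q x)) ≫ f = S.map (yonedaEquiv.symm x) ≫ S.map j ≫ f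
  rw [← S.map_comp_assoc, yonedaEquiv_symm_comp]

lemma toRestriction_comp_restrictionMap {S : SSet.{u} ⥤ SSet.{u}} {X E B : SSet.{u}}
    (f : S.obj X ⟶ E) (p : E ⟶ B) :
    toRestriction f ≫ restrictionMap S p = toRestriction (f ≫ p) :=
  hom_ext_app fun _ x => Category.assoc (S.map (yonedaEquiv.symm x)) f p

lemma toRestriction_comp_restrictionTrans {S S' : SSet.{u} ⥤ SSet.{u}} {X E : SSet.{u}}
    (l : S ⟶ S') (f : S'.obj X ⟶ E) :
    toRestriction f ≫ restrictionTrans l E = toRestriction (l.app X ≫ f) :=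
  hom_ext_app fun _ x => (l.naturality_assoc (yonedaEquiv.symm x) f).symm

/-- A description of the simplices of `S.obj X` as a sum of sets of simplices of `X`, natural
in `X`. -/
structure GenericDecomposition (S : SSet.{u} ⥤ SSet.{u}) where
  /-- the index set of the sum -/
  Index : SimplexCategoryᵒᵖ → Type
  /-- the dimensions of the summands -/
  dim : ∀ {q}, Index q → SimplexCategoryᵒᵖ
  /-- the decomposition -/
  equiv : ∀ q (X : SSet.{u}), (S.obj X).obj q ≃ Σ i : Index q, X.obj (dim i)
  equiv_map : ∀ {X Y : SSet.{u}} (f : X ⟶ Y) q z,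
    equiv q Y ((S.map f).app q z) = ⟨(equiv q X z).1, f.app _ (equiv q X z).2⟩

namespace GenericDecomposition

variable {S : SSet.{u} ⥤ SSet.{u}} (G : GenericDecomposition S)

/-- The generic simplices. -/
def gen {q : SimplexCategoryᵒᵖ} (i : G.Index q) :
    (S.obj (stdSimplex.obj (G.dim i).unop)).obj q :=
  (G.equiv q _).symm ⟨i, stdSimplex.objEquiv.symm (𝟙 _)⟩

/-- Every simplex of `S.obj X` thus comes from a generic one over a standard simplex, which is why
maps out of `S.obj X` are determined by their restrictions to the `S.obj Δ[n]`. -/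
lemma map_gen {q : SimplexCategoryᵒᵖ} {X : SSet.{u}} (i : G.Index q) (x : X.obj (G.dim i)) :
    (S.map (yonedaEquiv.symm x)).app q (G.gen i) = (G.equiv q X).symm ⟨i, x⟩ := by
  apply (G.equiv q X).injective
  rw [G.equiv_map, gen, Equiv.apply_symm_apply, Equiv.apply_symm_apply]
  exact congrArg (Sigma.mk i) (yonedaEquiv.apply_symm_apply x)

lemma toRestriction_injective (G : GenericDecomposition S) {X E : SSet.{u}} :
    Function.Injective (toRestriction : (S.obj X ⟶ E) → _) := by
  intro f g h
  refine hom_ext_app fun q z => ?_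
  obtain ⟨⟨i, x⟩, rfl⟩ := (G.equiv q X).symm.surjective z
  rw [← G.map_gen]
  exact ConcreteCategory.congr_hom
    (NatTrans.congr_app (ConcreteCategory.congr_hom (NatTrans.congr_app h _) x) q) (G.gen i)

/-- The value of a map to `restriction S E` on a simplex, as a map of simplicial sets. -/
abbrev restrictionApp {X E : SSet.{u}} (ψ : X ⟶ restriction S E) {q : SimplexCategoryᵒᵖ}
    (x : X.obj q) : S.obj (stdSimplex.obj q.unop) ⟶ E :=
  ψ.app q x

lemma restrictionApp_map {X E : SSet.{u}} (ψ : X ⟶ restriction S E) {p q : SimplexCategoryᵒᵖ}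
    (t : p ⟶ q) (x : X.obj p) :
    restrictionApp ψ (X.map t x) = S.map (SSet.stdSimplex.map t.unop) ≫ restrictionApp ψ x :=
  NatTrans.naturality_apply ψ t x

/-- Any presentation of a simplex of `S.obj X` through a standard simplex gives the same value as
the generic presentation. This consistency makes the map built in `toRestriction_surjective` natural
and a preimage of `ψ`. -/
lemma restrictionApp_gen {X E : SSet.{u}} (ψ : X ⟶ restriction S E) {q n : SimplexCategoryᵒᵖ}
    (z : (S.obj (stdSimplex.obj n.unop)).obj q) (x : X.obj n) :
    (restrictionApp ψ ((yonedaEquiv.symm x).app _ (G.equiv q _ z).2)).app q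
      (G.gen (G.equiv q _ z).1) = (restrictionApp ψ x).app q z := by
  obtain ⟨⟨i, y⟩, rfl⟩ := (G.equiv q _).symm.surjective z
  rw [Equiv.apply_symm_apply, ← G.map_gen]
  obtain ⟨t, rfl⟩ := stdSimplex.objEquiv.symm.surjective y
  exact ConcreteCategory.congr_hom (NatTrans.congr_app (restrictionApp_map ψ t.op x) q) (G.gen i)

lemma toRestriction_surjective (G : GenericDecomposition S) {X E : SSet.{u}} :
    Function.Surjective (toRestriction : (S.obj X ⟶ E) → _) := by
  intro ψ
  let φ : S.obj X ⟶ E :=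
    { app q := ↾fun z => (restrictionApp ψ (G.equiv q X z).2).app q (G.gen (G.equiv q X z).1)
      naturality := by
        intro p q t
        ext z
        obtain ⟨⟨i, x⟩, rfl⟩ := (G.equiv p X).symm.surjective z
        change (restrictionApp ψ (G.equiv q X ((S.obj X).map t _)).2).app q
            (G.gen (G.equiv q X ((S.obj X).map t _)).1) =
          E.map t ((restrictionApp ψ (G.equiv p X _).2).app p (G.gen (G.equiv p X _).1))
        rw [Equiv.apply_symm_apply, ← G.map_gen, ← NatTrans.naturality_apply, G.equiv_map]
        exact (G.restrictionApp_gen ψ _ x).trans (NatTrans.naturality_apply _ t _) }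
  refine ⟨φ, hom_ext_app fun q x => hom_ext_app fun p z => ?_⟩
  change (restrictionApp ψ (G.equiv p X ((S.map (yonedaEquiv.symm x)).app p z)).2).app p
    (G.gen (G.equiv p X ((S.map (yonedaEquiv.symm x)).app p z)).1) = (restrictionApp ψ x).app p z
  rw [G.equiv_map]
  exact G.restrictionApp_gen ψ z x

end GenericDecomposition

/-- The lifting property of the (virtual) pushout-product of a natural transformation
`l : S ⟶ S'` and a map `j : A ⟶ X`, with respect to a map `p : E ⟶ B`. -/
def LeibnizLifting {S S' : SSet.{u} ⥤ SSet.{u}} (l : S ⟶ S') {A X E B : SSet.{u}} (j : A ⟶ X)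
    (p : E ⟶ B) : Prop :=
  ∀ (a : S.obj X ⟶ E) (a' : S'.obj A ⟶ E) (b : S'.obj X ⟶ B),
    S.map j ≫ a = l.app A ≫ a' → a ≫ p = l.app X ≫ b → a' ≫ p = S'.map j ≫ b →
    ∃ k : S'.obj X ⟶ E, l.app X ≫ k = a ∧ S'.map j ≫ k = a' ∧ k ≫ p = b

lemma restrictionTrans_comp {S S' : SSet.{u} ⥤ SSet.{u}} (l : S ⟶ S') {E B : SSet.{u}}
    (p : E ⟶ B) : restrictionTrans l E ≫ restrictionMap S p =
      restrictionMap S' p ≫ restrictionTrans l B :=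
  hom_ext_app fun q (f : S'.obj (stdSimplex.obj q.unop) ⟶ E) => Category.assoc (l.app _) f p

/-- The (virtual) pullback-hom of a natural transformation and a map. -/
noncomputable def leibnizRestriction {S S' : SSet.{u} ⥤ SSet.{u}} (l : S ⟶ S') {E B : SSet.{u}}
    (p : E ⟶ B) : restriction S' E ⟶ pullback (restrictionMap S p) (restrictionTrans l B) :=
  pullback.lift (restrictionTrans l E) (restrictionMap S' p) (restrictionTrans_comp l p)

lemma leibnizRestriction_fst {S S' : SSet.{u} ⥤ SSet.{u}} (l : S ⟶ S') {E B : SSet.{u}}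
    (p : E ⟶ B) : leibnizRestriction l p ≫ pullback.fst _ _ = restrictionTrans l E :=
  pullback.lift_fst _ _ _

lemma leibnizRestriction_snd {S S' : SSet.{u} ⥤ SSet.{u}} (l : S ⟶ S') {E B : SSet.{u}}
    (p : E ⟶ B) : leibnizRestriction l p ≫ pullback.snd _ _ = restrictionMap S' p :=
  pullback.lift_snd _ _ _

/-- Both lifting problems correspond under `toRestriction`, which is bijective for `S` and `S'`.
Consequently, for fixed `l` and `p`, the admissible `j` form a left lifting class, closed under
coproducts, pushouts and transfinite compositions. -/
lemma leibnizLifting_iff {S S' : SSet.{u} ⥤ SSet.{u}} (G : GenericDecomposition S)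
    (G' : GenericDecomposition S') (l : S ⟶ S') {A X E B : SSet.{u}} (j : A ⟶ X) (p : E ⟶ B) :
    LeibnizLifting l j p ↔ HasLiftingProperty j (leibnizRestriction l p) := by
  constructor
  · refine fun h => ⟨fun {f g} sq => ?_⟩
    obtain ⟨a', rfl⟩ := G'.toRestriction_surjective f
    obtain ⟨a, ha⟩ := G.toRestriction_surjective (g ≫ pullback.fst _ _)
    obtain ⟨b, hb⟩ := G'.toRestriction_surjective (g ≫ pullback.snd _ _)
    obtain ⟨k, h₁, h₂, h₃⟩ := h a a' b
      (G.toRestriction_injective (by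
        rw [← comp_toRestriction, ha, ← sq.w_assoc, ← toRestriction_comp_restrictionTrans,
          leibnizRestriction_fst]))
      (G.toRestriction_injective (by
        rw [← toRestriction_comp_restrictionMap, ha, ← toRestriction_comp_restrictionTrans, hb,
          Category.assoc, Category.assoc, pullback.condition]))
      (G'.toRestriction_injective (by
        rw [← comp_toRestriction, hb, ← sq.w_assoc, ← toRestriction_comp_restrictionMap,
          leibnizRestriction_snd]))
    refine ⟨⟨toRestriction k, ?_, ?_⟩⟩
    · rw [comp_toRestriction, h₂]
    · apply pullback.hom_ext
      · rw [Category.assoc, leibnizRestriction_fst,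
          toRestriction_comp_restrictionTrans, h₁, ha]
      · rw [Category.assoc, leibnizRestriction_snd,
          toRestriction_comp_restrictionMap, h₃, hb]
  · intro h a a' b h₁ h₂ h₃
    have sq : CommSq (toRestriction a') j (leibnizRestriction l p)
        (pullback.lift (toRestriction a) (toRestriction b) (by
          rw [toRestriction_comp_restrictionMap, toRestriction_comp_restrictionTrans, h₂])) := by
      constructor
      apply pullback.hom_ext
      · rw [Category.assoc, leibnizRestriction_fst, Category.assoc,
          pullback.lift_fst, toRestriction_comp_restrictionTrans, comp_toRestriction, h₁]
      · rw [Category.assoc, leibnizRestriction_snd, Category.assoc,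
          pullback.lift_snd, toRestriction_comp_restrictionMap, comp_toRestriction, h₃]
    obtain ⟨k, hk⟩ := G'.toRestriction_surjective sq.lift
    have e := sq.fac_right
    refine ⟨k, G.toRestriction_injective ?_, G'.toRestriction_injective ?_,
      G'.toRestriction_injective ?_⟩
    · have := e =≫ pullback.fst _ _
      rw [pullback.lift_fst, Category.assoc, leibnizRestriction_fst, ← hk,
        toRestriction_comp_restrictionTrans] at this
      exact this
    · rw [← comp_toRestriction, hk, sq.fac_left]
    · have := e =≫ pullback.snd _ _
      rw [pullback.lift_snd, Category.assoc, leibnizRestriction_snd, ← hk,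
        toRestriction_comp_restrictionMap] at this
      exact this

end SSet

/-! ### The nerve of the category of elements and the first vertex map -/

namespace SSet

open Simplicial Limits HomotopicalAlgebra modelCategoryQuillen CartesianMonoidalCategory

/-- Chains of `q` composable simplicial operators. -/
abbrev OperatorChain (q : SimplexCategoryᵒᵖ) : Type := Fin (q.unop.len + 1) ⥤ SimplexCategoryᵒᵖ

namespace OperatorChain

variable {p q r : SimplexCategoryᵒᵖ}

/-- Restriction of chains along a simplicial operator. -/
abbrev res (t : p ⟶ q) (c : OperatorChain p) : OperatorChain q :=
  t.unop.toOrderHom.monotone.functor ⋙ c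

/-- The maps from the start of a chain. -/
abbrev from0 (c : OperatorChain q) (i : Fin (q.unop.len + 1)) : c.obj 0 ⟶ c.obj i :=
  c.map (homOfLE (Fin.zero_le i))

lemma from0_map (c : OperatorChain q) {i j : Fin (q.unop.len + 1)} (f : i ⟶ j) :
    c.from0 i ≫ c.map f = c.from0 j :=
  (c.map_comp _ _).symm

/-- The first vertices of the simplices of a chain. -/
def firstVertices (c : OperatorChain q) : q.unop ⟶ (c.obj 0).unop :=
  SimplexCategory.Hom.mk
    { toFun i := (c.from0 i).unop.toOrderHom 0
      monotone' i j h := by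
        dsimp only
        rw [← c.from0_map (homOfLE h)]
        exact (c.from0 i).unop.toOrderHom.monotone (Fin.zero_le _) }

lemma firstVertices_res (t : p ⟶ q) (c : OperatorChain p) :
    (c.res t).firstVertices ≫ (c.from0 (t.unop.toOrderHom 0)).unop = t.unop ≫ c.firstVertices := by
  ext i : 3
  change (c.from0 _ ≫ c.map (t.unop.toOrderHom.monotone.functor.map
      (homOfLE (Fin.zero_le i)))).unop.toOrderHom 0 =
    (c.from0 (t.unop.toOrderHom i)).unop.toOrderHom 0
  rw [c.from0_map]
  rfl

end OperatorChain

/-- The nerve of the category of elements of a simplicial set: its simplices consist of a chain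
of simplicial operators and a simplex in the starting dimension. -/
def elementsNerveObj (X : SSet.{u}) : SSet.{u} where
  obj q := Σ c : OperatorChain q, X.obj (c.obj 0)
  map t := ↾fun z => ⟨z.1.res t, X.map (z.1.from0 _) z.2⟩
  map_id q := by
    refine ConcreteCategory.hom_ext _ _ fun ⟨c, x⟩ => ?_
    refine Sigma.ext rfl (heq_of_eq ?_)
    change X.map (c.map (𝟙 _)) x = x
    rw [c.map_id, X.map_id]
    rfl
  map_comp s t := by
    refine ConcreteCategory.hom_ext _ _ fun ⟨c, x⟩ => ?_
    refine Sigma.ext rfl (heq_of_eq ?_)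
    change X.map (c.from0 _) x = X.map (c.map _) (X.map (c.from0 _) x)
    rw [← Functor.map_comp_apply]
    exact congrArg (fun f => X.map f x) (c.from0_map _).symm

/-- The functor sending a simplicial set to the nerve of its category of elements. -/
def elementsNerve : SSet.{u} ⥤ SSet.{u} where
  obj := elementsNerveObj
  map f :=
    { app q := ↾fun z => ⟨z.1, f.app _ z.2⟩
      naturality p q t := by
        refine ConcreteCategory.hom_ext _ _ fun ⟨c, x⟩ => ?_
        have e := NatTrans.naturality_apply f (c.from0 (t.unop.toOrderHom 0)) x
        exact congrArg (Sigma.mk (c.res t)) e }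

/-- The first vertex map. -/
def firstVertexMap : elementsNerve.{u} ⟶ 𝟭 SSet.{u} where
  app X :=
    { app q := ↾fun z => X.map z.1.firstVertices.op z.2
      naturality p q t := by
        ext ⟨c, x⟩
        change X.map (c.res t).firstVertices.op (X.map (c.from0 _) x) =
          X.map t (X.map c.firstVertices.op x)
        rw [← Functor.map_comp_apply, ← Functor.map_comp_apply]
        exact congrArg (fun s : c.obj 0 ⟶ q => X.map s x)
          (congrArg Quiver.Hom.op (c.firstVertices_res t)) }
  naturality X Y f := by
    refine hom_ext_app fun q ⟨c, x⟩ => ?_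
    exact (NatTrans.naturality_apply f _ x).symm

/-- The decomposition of `elementsNerve` according to the chain of operators. -/
def elementsNerveDecomposition : GenericDecomposition elementsNerve.{u} where
  Index := OperatorChain
  dim c := c.obj 0
  equiv _ _ := Equiv.refl _
  equiv_map _ _ _ := rfl

end SSet

/-! ### The mapping cylinder of a natural transformation `S ⟶ 𝟭` -/

namespace SSet

open Simplicial Limits HomotopicalAlgebra modelCategoryQuillen CartesianMonoidalCategory

namespace GenericDecomposition

lemma map_injective {S : SSet.{u} ⥤ SSet.{u}} (G : GenericDecomposition S) {X Y : SSet.{u}}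
    (f : X ⟶ Y) [Mono f] (q : SimplexCategoryᵒᵖ) : Function.Injective ((S.map f).app q) := by
  intro z z' h
  apply (G.equiv q X).injective
  have := congrArg (G.equiv q Y) h
  rw [G.equiv_map, G.equiv_map] at this
  generalize G.equiv q X z = w at *
  generalize G.equiv q X z' = w' at *
  obtain ⟨i, x⟩ := w
  obtain ⟨i', x'⟩ := w'
  obtain rfl : i = i' := congrArg Sigma.fst this
  have e := eq_of_heq (Sigma.mk.inj this).2
  exact congrArg (Sigma.mk i) ((mono_iff_injective (f.app _)).1 inferInstance e)

end GenericDecomposition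

variable {S : SSet.{u} ⥤ SSet.{u}} (τ : S ⟶ 𝟭 SSet.{u})

/-- The simplices of the mapping cylinder of a natural transformation. -/
abbrev CylinderSimplex (S : SSet.{u} ⥤ SSet.{u}) (X : SSet.{u}) (q : SimplexCategoryᵒᵖ) : Type u :=
  {φ : q.unop ⟶ ⦋1⦌ // φ.toOrderHom 0 = 0} × (S.obj X).obj q ⊕ X.obj q

/-- The simplices of the mapping cylinder given by simplices of the cylinder. -/
def cylinderMk {X : SSet.{u}} {q : SimplexCategoryᵒᵖ} (φ : q.unop ⟶ ⦋1⦌) (y : (S.obj X).obj q) :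
    CylinderSimplex S X q :=
  if h : φ.toOrderHom 0 = 0 then .inl (⟨φ, h⟩, y) else .inr ((τ.app X).app q y)

lemma inl_eq_cylinderMk {X : SSet.{u}} {q : SimplexCategoryᵒᵖ}
    (φ : {φ : q.unop ⟶ ⦋1⦌ // φ.toOrderHom 0 = 0}) (y : (S.obj X).obj q) :
    (.inl (φ, y) : CylinderSimplex S X q) = cylinderMk τ φ.1 y := by
  rw [cylinderMk, dif_pos φ.2]

lemma cylinderMk_of_ne {X : SSet.{u}} {q : SimplexCategoryᵒᵖ} {φ : q.unop ⟶ ⦋1⦌}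
    (h : φ.toOrderHom 0 ≠ 0) (y : (S.obj X).obj q) :
    cylinderMk τ φ y = .inr ((τ.app X).app q y) :=
  dif_neg h

/-- The action of simplicial operators on the simplices of the mapping cylinder. -/
def cylinderRes {X : SSet.{u}} {p q : SimplexCategoryᵒᵖ} (t : p ⟶ q) :
    CylinderSimplex S X p → CylinderSimplex S X q :=
  Sum.elim (fun z => cylinderMk τ (t.unop ≫ z.1.1) ((S.obj X).map t z.2))
    (fun x => .inr (X.map t x))

/-- An operator can move a simplex off the source side into the target, but never back: if `φ`
starts at `1`, so does its restriction, and naturality of `τ` gives the equality. With it,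
functoriality is checked on `cylinderMk` without tracking cases. -/
lemma cylinderRes_mk {X : SSet.{u}} {p q : SimplexCategoryᵒᵖ} (t : p ⟶ q) (φ : p.unop ⟶ ⦋1⦌)
    (y : (S.obj X).obj p) :
    cylinderRes τ t (cylinderMk τ φ y) = cylinderMk τ (t.unop ≫ φ) ((S.obj X).map t y) := by
  by_cases h : φ.toOrderHom 0 = 0
  · rw [← inl_eq_cylinderMk τ ⟨φ, h⟩]
    rfl
  · rw [cylinderMk_of_ne _ h, cylinderMk_of_ne, NatTrans.naturality_apply]
    · rfl
    · intro h'
      exact h (le_antisymm ((φ.toOrderHom.monotone (Fin.zero_le (t.unop.toOrderHom 0))).trans h'.le)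
        (Fin.zero_le _))

/-- The mapping cylinder of a natural transformation. -/
def mappingCylinderObj (X : SSet.{u}) : SSet.{u} where
  obj q := CylinderSimplex S X q
  map t := ↾cylinderRes τ t
  map_id q := by
    refine ConcreteCategory.hom_ext _ _ fun z => ?_
    obtain ⟨φ, y⟩ | x := z
    · rw [inl_eq_cylinderMk τ]
      refine (cylinderRes_mk τ _ _ _).trans ?_
      rw [Functor.map_id_apply]
      change cylinderMk τ (𝟙 _ ≫ φ.1) y = cylinderMk τ φ.1 y
      rw [Category.id_comp]
    · exact congrArg Sum.inr (Functor.map_id_apply X q x)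
  map_comp s t := by
    refine ConcreteCategory.hom_ext _ _ fun z => ?_
    obtain ⟨φ, y⟩ | x := z
    · rw [inl_eq_cylinderMk τ]
      refine (cylinderRes_mk τ _ _ _).trans ?_
      change _ = cylinderRes τ t (cylinderRes τ s _)
      rw [cylinderRes_mk, cylinderRes_mk, Functor.map_comp_apply]
      rfl
    · exact congrArg Sum.inr (Functor.map_comp_apply X s t x)

/-- The functoriality of the mapping cylinder, on simplices. -/
def cylinderMap {X Y : SSet.{u}} (f : X ⟶ Y) (q : SimplexCategoryᵒᵖ) :
    CylinderSimplex S X q → CylinderSimplex S Y q :=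
  Sum.map (fun z => (z.1, (S.map f).app q z.2)) (f.app q)

lemma cylinderMap_mk {X Y : SSet.{u}} (f : X ⟶ Y) {q : SimplexCategoryᵒᵖ} (φ : q.unop ⟶ ⦋1⦌)
    (y : (S.obj X).obj q) :
    cylinderMap f q (cylinderMk τ φ y) = cylinderMk τ φ ((S.map f).app q y) := by
  by_cases h : φ.toOrderHom 0 = 0
  · rw [← inl_eq_cylinderMk τ ⟨φ, h⟩, ← inl_eq_cylinderMk τ ⟨φ, h⟩]
    rfl
  · rw [cylinderMk_of_ne _ h, cylinderMk_of_ne _ h]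
    exact congrArg Sum.inr (ConcreteCategory.congr_hom
      (NatTrans.congr_app (τ.naturality f) q) y).symm

/-- The mapping cylinder functor of a natural transformation. -/
def mappingCylinder : SSet.{u} ⥤ SSet.{u} where
  obj := mappingCylinderObj τ
  map f :=
    { app q := ↾cylinderMap f q
      naturality p q t := by
        refine ConcreteCategory.hom_ext _ _ fun z => ?_
        obtain ⟨φ, y⟩ | x := z
        · rw [inl_eq_cylinderMk τ]
          change cylinderMap f q (cylinderRes τ t _) = cylinderRes τ t (cylinderMap f p _)
          rw [cylinderRes_mk, cylinderMap_mk, cylinderMap_mk, cylinderRes_mk,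
            NatTrans.naturality_apply]
        · exact congrArg Sum.inr (NatTrans.naturality_apply f t x) }
  map_id X := by
    refine hom_ext_app fun q z => ?_
    obtain ⟨φ, y⟩ | x := z
    · change Sum.inl (φ, (S.map (𝟙 X)).app q y) = _
      rw [S.map_id]
      rfl
    · rfl
  map_comp f g := by
    refine hom_ext_app fun q z => ?_
    obtain ⟨φ, y⟩ | x := z
    · change Sum.inl (φ, (S.map (f ≫ g)).app q y) = _
      rw [S.map_comp]
      rfl
    · rfl

namespace mappingCylinder

/-- The map from the cylinder to the mapping cylinder. -/
def fromCylinder (X : SSet.{u}) : S.obj X ⊗ Δ[1] ⟶ (mappingCylinder τ).obj X where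
  app q := ↾fun z => cylinderMk τ (stdSimplex.objEquiv z.2) z.1
  naturality p q t := by
    refine ConcreteCategory.hom_ext _ _ fun ⟨y, φ⟩ => ?_
    exact (cylinderRes_mk τ t _ y).symm

/-- The inclusion of the target in the mapping cylinder. -/
def target (X : SSet.{u}) : X ⟶ (mappingCylinder τ).obj X where
  app q := ↾Sum.inr

/-- The inclusion of the source in the mapping cylinder. -/
noncomputable def source : S ⟶ mappingCylinder τ where
  app X := ι₀ ≫ fromCylinder τ X
  naturality X Y f := by
    refine hom_ext_app fun q y => ?_
    exact (cylinderMap_mk τ f (stdSimplex.objEquiv (ι₀.app q y).2) y).symm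

lemma ι₁_fromCylinder (X : SSet.{u}) :
    ι₁ ≫ fromCylinder τ X = τ.app X ≫ target τ X :=
  hom_ext_app fun q y => by
    refine cylinderMk_of_ne τ (φ := stdSimplex.objEquiv (ι₁.app q y).2) ?_ y
    exact one_ne_zero (α := Fin 2)

/-- Maps out of the mapping cylinder, on simplices. -/
def descFun {X E : SSet.{u}} (h : S.obj X ⊗ Δ[1] ⟶ E) (e : X ⟶ E) (q : SimplexCategoryᵒᵖ) :
    CylinderSimplex S X q → E.obj q :=
  Sum.elim (fun z => h.app q (z.2, stdSimplex.objEquiv.symm z.1.1)) (e.app q)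

lemma descFun_mk {X E : SSet.{u}} (h : S.obj X ⊗ Δ[1] ⟶ E) (e : X ⟶ E)
    (w : ι₁ ≫ h = τ.app X ≫ e) {q : SimplexCategoryᵒᵖ} (φ : q.unop ⟶ ⦋1⦌) (y : (S.obj X).obj q) :
    descFun h e q (cylinderMk τ φ y) = h.app q (y, stdSimplex.objEquiv.symm φ) := by
  by_cases hφ : φ.toOrderHom 0 = 0
  · rw [← inl_eq_cylinderMk τ ⟨φ, hφ⟩]
    rfl
  · rw [cylinderMk_of_ne _ hφ]
    refine (ConcreteCategory.congr_hom (NatTrans.congr_app w q) y).symm.trans ?_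
    exact congrArg (h.app q) (ι₁_app y _ (Fin.eq_one_of_ne_zero _ hφ))

/-- Maps out of the mapping cylinder. -/
def desc {X E : SSet.{u}} (h : S.obj X ⊗ Δ[1] ⟶ E) (e : X ⟶ E) (w : ι₁ ≫ h = τ.app X ≫ e) :
    (mappingCylinder τ).obj X ⟶ E where
  app q := ↾descFun h e q
  naturality p q t := by
    refine ConcreteCategory.hom_ext _ _ fun z => ?_
    obtain ⟨φ, y⟩ | x := z
    · rw [inl_eq_cylinderMk τ]
      change descFun h e q (cylinderRes τ t _) = E.map t (descFun h e p _)
      rw [cylinderRes_mk, descFun_mk τ h e w, descFun_mk τ h e w]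
      let z : (S.obj X ⊗ Δ[1]).obj p := (y, stdSimplex.objEquiv.symm φ.1)
      exact NatTrans.naturality_apply h t z
    · exact NatTrans.naturality_apply e t x

section

variable {X E : SSet.{u}} (h : S.obj X ⊗ Δ[1] ⟶ E) (e : X ⟶ E) (w : ι₁ ≫ h = τ.app X ≫ e)

lemma fromCylinder_desc : fromCylinder τ X ≫ desc τ h e w = h :=
  hom_ext_app fun _ ⟨y, φ⟩ => descFun_mk τ h e w (stdSimplex.objEquiv φ) y

lemma target_desc : target τ X ≫ desc τ h e w = e := rfl

lemma hom_ext {f g : (mappingCylinder τ).obj X ⟶ E}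
    (h₁ : fromCylinder τ X ≫ f = fromCylinder τ X ≫ g)
    (h₂ : target τ X ≫ f = target τ X ≫ g) : f = g := by
  refine hom_ext_app fun q z => ?_
  obtain ⟨φ, y⟩ | x := z
  · rw [inl_eq_cylinderMk τ]
    let z : (S.obj X ⊗ Δ[1]).obj q := (y, stdSimplex.objEquiv.symm φ.1)
    exact ConcreteCategory.congr_hom (NatTrans.congr_app h₁ q) z
  · exact ConcreteCategory.congr_hom (NatTrans.congr_app h₂ q) x

end

/-- The projection of the mapping cylinder onto the target. -/
def proj (X : SSet.{u}) : (mappingCylinder τ).obj X ⟶ X :=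
  desc τ (fst _ _ ≫ τ.app X) (𝟙 X) rfl

lemma source_proj (X : SSet.{u}) : (source τ).app X ≫ proj τ X = τ.app X := by
  refine (Category.assoc ι₀ (fromCylinder τ X) (proj τ X)).trans ?_
  exact congrArg (ι₀ ≫ ·) (fromCylinder_desc τ _ _ _)

lemma anodyne_target (X : SSet.{u}) : anodyneExtensions (target τ X) := by
  refine .of_exists_lift fun E B p _ f b w => ?_
  -- Homotopy extension relative to the empty subobject is plain lifting against `ι₁`, of which
  -- `target` is a pushout.
  obtain ⟨l, h₁, -, h₂⟩ := exists_homotopy_extension_one (initial.to (S.obj X)) p (τ.app X ≫ f)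
    ((initialIsInitial.ofStrict (fst _ _)).to E) (fromCylinder τ X ≫ b)
    (initialIsInitial.hom_ext _ _) (by rw [Category.assoc, w, ← reassoc_of% (ι₁_fromCylinder τ X)])
    ((initialIsInitial.ofStrict (fst _ _)).hom_ext _ _)
  refine ⟨desc τ l f h₁, target_desc τ _ _ _, hom_ext τ ?_ ?_⟩
  · rw [reassoc_of% (fromCylinder_desc τ l f h₁), h₂]
  · rw [reassoc_of% (target_desc τ l f h₁), w]

instance mono_source (X : SSet.{u}) : Mono ((source τ).app X) := by
  have (q : SimplexCategoryᵒᵖ) : Mono (((source τ).app X).app q) :=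
    (mono_iff_injective _).2 fun y y' h => congrArg Prod.snd (Sum.inl_injective h)
  exact NatTrans.mono_of_mono_app _

lemma map_injective (G : GenericDecomposition S) {X Y : SSet.{u}} (f : X ⟶ Y) [Mono f]
    (q : SimplexCategoryᵒᵖ) : Function.Injective (((mappingCylinder τ).map f).app q) :=
  Sum.map_injective.2 ⟨fun _ _ h => Prod.ext (Prod.mk.inj h).1
    (G.map_injective f q (Prod.mk.inj h).2), (mono_iff_injective (f.app _)).1 inferInstance⟩

/-- The type of the second component depends on the first, so the pair has to be replaced as a
whole. -/
lemma decomposition_aux {Φ I J : Type} {d : I → SimplexCategoryᵒᵖ} {d' : J → SimplexCategoryᵒᵖ}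
    {X : SSet.{u}} (φ : Φ) {z z' : Σ i : I, X.obj (d i)} (h : z = z') :
    (⟨Sum.inl (φ, z.1), z.2⟩ :
      Σ i : (Φ × I) ⊕ J, X.obj (Sum.elim (fun i => d i.2) d' i)) = ⟨Sum.inl (φ, z'.1), z'.2⟩ := by
  rw [h]

/-- The decomposition of the mapping cylinder induced by a decomposition of the source. -/
def decomposition (G : GenericDecomposition S) :
    GenericDecomposition (mappingCylinder τ) where
  Index q := {φ : q.unop ⟶ ⦋1⦌ // φ.toOrderHom 0 = 0} × G.Index q ⊕ Unit
  dim {q} := Sum.elim (fun i => G.dim i.2) (fun _ => q)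
  equiv q X :=
    { toFun := Sum.elim (fun z => ⟨.inl (z.1, (G.equiv q X z.2).1), (G.equiv q X z.2).2⟩)
        (fun x => ⟨.inr (), x⟩)
      invFun z := match z with
        | ⟨.inl i, x⟩ => .inl (i.1, (G.equiv q X).symm ⟨i.2, x⟩)
        | ⟨.inr _, x⟩ => .inr x
      left_inv z := match z with
        | .inl z => congrArg (fun y => Sum.inl (z.1, y)) ((G.equiv q X).symm_apply_apply z.2)
        | .inr x => rfl
      right_inv z := match z with
        | ⟨.inl i, x⟩ => decomposition_aux i.1 ((G.equiv q X).apply_symm_apply ⟨i.2, x⟩)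
        | ⟨.inr _, x⟩ => rfl }
  equiv_map {X Y} f q z := by
    obtain ⟨φ, y⟩ | x := z
    · exact decomposition_aux φ (G.equiv_map f q y)
    · rfl

/-- The pushout of the source along a monomorphism is a subobject of the mapping cylinder. -/
lemma mono_of_isPushout (G : GenericDecomposition S) {A X P : SSet.{u}} (j : A ⟶ X) [Mono j]
    {inl : S.obj X ⟶ P} {inr : (mappingCylinder τ).obj A ⟶ P}
    (sq : IsPushout (S.map j) ((source τ).app A) inl inr) (k : P ⟶ (mappingCylinder τ).obj X)
    (hl : inl ≫ k = (source τ).app X) (hr : inr ≫ k = (mappingCylinder τ).map j) : Mono k := by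
  have (q : SimplexCategoryᵒᵖ) : Mono (k.app q) := by
    rw [mono_iff_injective]
    have hl' (y) : k.app q (inl.app q y) = ((source τ).app X).app q y :=
      ConcreteCategory.congr_hom (NatTrans.congr_app hl q) y
    have hr' (m) : k.app q (inr.app q m) = ((mappingCylinder τ).map j).app q m :=
      ConcreteCategory.congr_hom (NatTrans.congr_app hr q) m
    have w (y) : inl.app q ((S.map j).app q y) = inr.app q (((source τ).app A).app q y) :=
      ConcreteCategory.congr_hom (NatTrans.congr_app sq.w q) y
    have key (y m) (h : k.app q (inl.app q y) = k.app q (inr.app q m)) :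
        inl.app q y = inr.app q m := by
      rw [hl', hr'] at h
      obtain ⟨φ, y'⟩ | x := m
      · have h' := Prod.mk.inj (Sum.inl_injective h)
        obtain rfl : y = (S.map j).app q y' := h'.2
        obtain rfl := h'.1
        exact w y'
      · cases h
    have surj (z : P.obj q) : (∃ y, inl.app q y = z) ∨ ∃ m, inr.app q m = z :=
      Types.eq_or_eq_of_isPushout (sq.map ((evaluation _ _).obj q)) z
    intro z z' h
    obtain ⟨y, rfl⟩ | ⟨m, rfl⟩ := surj z <;> obtain ⟨y', rfl⟩ | ⟨m', rfl⟩ := surj z'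
    · rw [hl', hl'] at h
      rw [(mono_iff_injective (((source τ).app X).app q)).1 inferInstance h]
    · exact key _ _ h
    · exact (key _ _ h.symm).symm
    · rw [hr', hr'] at h
      rw [map_injective τ G j q h]
  exact NatTrans.mono_of_mono_app _

end mappingCylinder

end SSet

/-! ### Induction over cells for the source inclusion -/

namespace SSet

open Simplicial Limits HomotopicalAlgebra modelCategoryQuillen CartesianMonoidalCategory

namespace mappingCylinder

variable {S : SSet.{u} ⥤ SSet.{u}} (τ : S ⟶ 𝟭 SSet.{u})

/-- Let `P` be the pushout of `S.obj X` and the cylinder on `A`. The map from `S.obj X` to `P` is a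
pushout of the source inclusion at `A`, and its composite with the monomorphism from `P` to the
cylinder on `X` is the source inclusion at `X`. Right cancellation makes that monomorphism anodyne.
-/
lemma leibnizLifting_of_anodyne (G : GenericDecomposition S) {A X : SSet.{u}} (j : A ⟶ X) [Mono j]
    (hA : anodyneExtensions ((source τ).app A)) (hX : anodyneExtensions ((source τ).app X))
    {E B : SSet.{u}} (p : E ⟶ B) [Fibration p] : LeibnizLifting (source τ) j p := by
  intro a a' b w₁ w₂ w₃
  let sq := IsPushout.of_hasPushout (S.map j) ((source τ).app A)
  let k := sq.desc _ _ ((source τ).naturality j)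
  have := mono_of_isPushout τ G j sq k (sq.inl_desc _ _ _) (sq.inr_desc _ _ _)
  have hk : anodyneExtensions k := by
    refine .of_comp (MorphismProperty.of_isPushout sq hA) ?_
    rwa [sq.inl_desc]
  obtain ⟨l, h₁, h₂⟩ := hk.exists_lift p (sq.desc a a' w₁) b (by
    apply sq.hom_ext
    · rw [sq.inl_desc_assoc, sq.inl_desc_assoc, w₂]
    · rw [sq.inr_desc_assoc, sq.inr_desc_assoc, w₃])
  refine ⟨l, ?_, ?_, h₂⟩
  · rw [← sq.inl_desc _ _ ((source τ).naturality j), Category.assoc, h₁, sq.inl_desc]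
  · rw [← sq.inr_desc _ _ ((source τ).naturality j), Category.assoc, h₁, sq.inr_desc]

lemma anodyne_of_leibnizLifting (G : GenericDecomposition S) (X : SSet.{u})
    (h : ∀ ⦃E B : SSet.{u}⦄ (p : E ⟶ B) [Fibration p],
      LeibnizLifting (source τ) (Subcomplex.ι (⊥ : X.Subcomplex)) p) :
    anodyneExtensions ((source τ).app X) := by
  refine .of_exists_lift fun E B p _ a b w => ?_
  -- A decomposable functor sends the empty simplicial set to an initial object, so only the lifting
  -- problem for the source inclusion at `X` remains.
  have hom_ext {S' : SSet.{u} ⥤ SSet.{u}} (G' : GenericDecomposition S') {E : SSet.{u}}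
      (f g : S'.obj (⊥ : X.Subcomplex) ⟶ E) : f = g :=
    G'.toRestriction_injective (Subcomplex.isInitialBot.hom_ext _ _)
  obtain ⟨a', -⟩ := (decomposition τ G).toRestriction_surjective
    (Subcomplex.isInitialBot.to (restriction (mappingCylinder τ) E) :
      ((⊥ : X.Subcomplex) : SSet) ⟶ _)
  obtain ⟨l, h₁, -, h₂⟩ := h p a a' b (hom_ext G _ _) w (hom_ext (decomposition τ G) _ _)
  exact ⟨l, h₁, h₂⟩

/-- Such an `X` is built from the empty simplicial set by attaching cells of dimension `< n`, and
`leibnizLifting_iff` makes the property stable under cell attachment. -/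
lemma anodyne_source_of_dimension (G : GenericDecomposition S) (X : SSet.{u}) (n : ℕ)
    [X.HasDimensionLT n]
    (h : ∀ m < n, ∀ ⦃E B : SSet.{u}⦄ (p : E ⟶ B) [Fibration p],
      LeibnizLifting (source τ) (∂Δ[m] : Δ[m].Subcomplex).ι p) :
    anodyneExtensions ((source τ).app X) := by
  refine anodyne_of_leibnizLifting τ G X fun E B p _ => ?_
  rw [leibnizLifting_iff G (decomposition τ G)]
  let I : MorphismProperty SSet.{u} := .ofHoms (fun m : Fin n => (∂Δ[m.1] : Δ[m.1].Subcomplex).ι)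
  refine MorphismProperty.transfiniteCompositionsOfShape_pushouts_coproducts_le_llp_rlp.{u} I ℕ _
    ⟨(relativeCellComplex X).transfiniteCompositionOfShape' fun s => ?_⟩ _ ?_
  · exact ⟨(⟨s.j, X.dim_lt_of_nonDegenerate ⟨_, s.k.nonDegenerate⟩ n⟩ : Fin n)⟩
  · rintro _ _ _ ⟨m⟩
    rw [← leibnizLifting_iff G (decomposition τ G)]
    exact h m.1 m.2 p

/-- The inclusion of the source of a mapping cylinder is anodyne if it is so for the standard
simplices. -/
theorem anodyne_source (G : GenericDecomposition S)
    (h : ∀ n : ℕ, anodyneExtensions ((source τ).app Δ[n])) (X : SSet.{u}) :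
    anodyneExtensions ((source τ).app X) := by
  -- The boundary `∂Δ[n]` has dimension `< n`, so the induction hypothesis makes its source
  -- inclusion anodyne; the one at `Δ[n]` is anodyne by assumption, and the two combine to the
  -- lifting property for the boundary inclusion.
  have key (n : ℕ) : ∀ ⦃E B : SSet.{u}⦄ (p : E ⟶ B) [Fibration p],
      LeibnizLifting (source τ) (∂Δ[n] : Δ[n].Subcomplex).ι p := by
    induction n using Nat.strong_induction_on with
    | h n ih =>
      intro E B p _
      exact leibnizLifting_of_anodyne τ G _ (anodyne_source_of_dimension τ G _ n ih) (h n) p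
  refine anodyne_of_leibnizLifting τ G X fun E B p _ => ?_
  rw [leibnizLifting_iff G (decomposition τ G)]
  -- Lifting against boundary inclusions implies lifting against all monomorphisms, in particular
  -- against the inclusion of the empty subobject.
  have : (MorphismProperty.monomorphisms SSet.{u}).rlp (leibnizRestriction (source τ) p) := by
    rw [rlp_monomorphisms]
    rintro _ _ _ ⟨n⟩
    rw [← leibnizLifting_iff G (decomposition τ G)]
    exact key n p
  exact this _ (inferInstanceAs (Mono _))

end mappingCylinder

end SSet

/-! ### Homotopies from natural transformations; contracting the elements of `Δ[n]` -/

namespace CategoryTheory.NatTrans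

variable {J : Type u} [Category.{v} J] {D : Type u'} [Category.{v'} D]

/-- A natural transformation, considered as a functor to the category of arrows. -/
def arrows {F G : J ⥤ D} (ν : F ⟶ G) : J ⥤ ComposableArrows D 1 where
  obj j := ComposableArrows.mk₁ (ν.app j)
  map f := ComposableArrows.homMk₁ (F.map f) (G.map f) (ν.naturality f).symm
  map_id j := ComposableArrows.hom_ext₁ (F.map_id j) (G.map_id j)
  map_comp f g := ComposableArrows.hom_ext₁ (F.map_comp f g) (G.map_comp f g)

/-- For a natural transformation `ν : F ⟶ G` and a functor `φ` to `{0 → 1}`, this is the functor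
given by `F` where `φ` is `0`, and by `G` where it is `1`. -/
def switch {F G : J ⥤ D} (ν : F ⟶ G) (φ : J ⥤ Fin 2) : J ⥤ D :=
  (𝟭 J).prod' φ ⋙ Functor.uncurry.obj ν.arrows

/-- The canonical map from the source of `ν` to `ν.switch φ`. -/
def toSwitch {F G : J ⥤ D} (ν : F ⟶ G) (φ : J ⥤ Fin 2) (j : J) :
    F.obj j ⟶ (ν.switch φ).obj j :=
  (ν.arrows.obj j).map (homOfLE (Fin.zero_le (φ.obj j)))

lemma switch_map {F G : J ⥤ D} (ν : F ⟶ G) (φ : J ⥤ Fin 2) {j j' : J} (f : j ⟶ j') :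
    (ν.switch φ).map f = (ν.arrows.map f).app (φ.obj j) ≫ (ν.arrows.obj j').map (φ.map f) := rfl

lemma toSwitch_naturality {F G : J ⥤ D} (ν : F ⟶ G) (φ : J ⥤ Fin 2) {j j' : J} (f : j ⟶ j') :
    ν.toSwitch φ j ≫ (ν.switch φ).map f = F.map f ≫ ν.toSwitch φ j' := by
  have e₁ := (ν.arrows.map f).naturality (homOfLE (Fin.zero_le (φ.obj j)))
  have e₂ := (ν.arrows.obj j').map_comp (homOfLE (Fin.zero_le (φ.obj j))) (φ.map f)
  refine (Category.assoc _ _ _).symm.trans ((congrArg (· ≫ _) e₁).trans ?_)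
  exact (Category.assoc _ _ _).trans (congrArg (F.map f ≫ ·) e₂.symm)

lemma switch_zero {F G : J ⥤ D} (ν : F ⟶ G) : ν.switch ((Functor.const J).obj 0) = F := by
  refine Functor.hext (fun _ => rfl) fun j j' f => heq_of_eq ?_
  rw [switch_map]
  exact (congrArg (_ ≫ ·) ((ν.arrows.obj j').map_id 0)).trans (Category.comp_id _)

lemma switch_one {F G : J ⥤ D} (ν : F ⟶ G) : ν.switch ((Functor.const J).obj 1) = G := by
  refine Functor.hext (fun _ => rfl) fun j j' f => heq_of_eq ?_
  rw [switch_map]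
  exact (congrArg (_ ≫ ·) ((ν.arrows.obj j').map_id 1)).trans (Category.comp_id _)

lemma toSwitch_zero {F G : J ⥤ D} (ν : F ⟶ G) (j : J) :
    ν.toSwitch ((Functor.const J).obj 0) j = 𝟙 (F.obj j) :=
  (ν.arrows.obj j).map_id 0

lemma mk₁_id (d : D) : ComposableArrows.mk₁ (𝟙 d) = (Functor.const (Fin 2)).obj d :=
  ComposableArrows.ext₁ rfl rfl (by simp; exact (Category.id_comp _).symm)

lemma arrows_const (d : D) :
    arrows (𝟙 ((Functor.const J).obj d)) =
      (Functor.const J).obj ((Functor.const (Fin 2)).obj d) := by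
  rw [← mk₁_id]
  exact Functor.hext (fun _ => rfl) (fun _ _ _ => heq_of_eq (ComposableArrows.hom_ext₁ rfl rfl))

end CategoryTheory.NatTrans

namespace SSet

open Simplicial Limits HomotopicalAlgebra modelCategoryQuillen CartesianMonoidalCategory

/-- The functor corresponding to a simplex of `Δ[1]`. -/
abbrev edgeFunctor {q : SimplexCategoryᵒᵖ} (φ : Δ[1].obj q) : Fin (q.unop.len + 1) ⥤ Fin 2 :=
  (stdSimplex.objEquiv φ).toOrderHom.monotone.functor

namespace OperatorChain

variable {q : SimplexCategoryᵒᵖ} {n : SimplexCategory}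

/-- The cone on a chain given by an operator to its start. -/
def cone (c : OperatorChain q) (α : op n ⟶ c.obj 0) : (Functor.const _).obj (op n) ⟶ c where
  app i := α ≫ c.from0 i
  naturality i j f := by
    rw [Category.assoc, c.from0_map]
    exact Category.id_comp _

end OperatorChain

/-- The contraction of the nerve of the category of elements of a standard simplex, on
simplices. -/
def contractionFun {n : SimplexCategory} {q : SimplexCategoryᵒᵖ} (c : OperatorChain q)
    (α : op n ⟶ c.obj 0) (φ : Fin (q.unop.len + 1) ⥤ Fin 2) :
    (elementsNerve.{u}.obj (stdSimplex.obj n)).obj q :=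
  ⟨(c.cone α).switch φ, stdSimplex.objEquiv.symm ((c.cone α).toSwitch φ 0).unop⟩

/-- Cones are compatible with restriction of chains; since restriction may move the start of the
chain, the leading operators are matched by `toSwitch_naturality`. -/
lemma contractionFun_res {n : SimplexCategory} {p q : SimplexCategoryᵒᵖ} (t : p ⟶ q)
    (c : OperatorChain p) (α : op n ⟶ c.obj 0) (φ : Fin (p.unop.len + 1) ⥤ Fin 2) :
    contractionFun.{u} (c.res t) (α ≫ c.from0 (t.unop.toOrderHom 0))
        (t.unop.toOrderHom.monotone.functor ⋙ φ) =
      (elementsNerve.{u}.obj (stdSimplex.obj n)).map t (contractionFun c α φ) := by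
  have e : (c.res t).cone (α ≫ c.from0 (t.unop.toOrderHom 0)) =
      Functor.whiskerLeft t.unop.toOrderHom.monotone.functor (c.cone α) := by
    ext i : 2
    exact (Category.assoc _ _ _).trans (congrArg (α ≫ ·) (c.from0_map _))
  refine Eq.trans (b := ⟨_, stdSimplex.objEquiv.symm ((Functor.whiskerLeft
    t.unop.toOrderHom.monotone.functor (c.cone α)).toSwitch _ 0).unop⟩)
    (congrArg (fun ν : (Functor.const _).obj (op n) ⟶ c.res t =>
      (⟨ν.switch _, stdSimplex.objEquiv.symm (ν.toSwitch _ 0).unop⟩ :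
      (elementsNerve.{u}.obj (stdSimplex.obj n)).obj q)) e) ?_
  refine congrArg (Sigma.mk _) (stdSimplex.objEquiv.injective ?_)
  refine congrArg Quiver.Hom.unop (?_ : _ = (c.cone α).toSwitch φ 0 ≫ ((c.cone α).switch φ).map _)
  exact (Category.id_comp _).symm.trans ((c.cone α).toSwitch_naturality φ
    (homOfLE (Fin.zero_le (t.unop.toOrderHom 0)))).symm

/-- The contraction of the nerve of the category of elements of a standard simplex. -/
def contraction (n : SimplexCategory) :
    elementsNerve.{u}.obj (stdSimplex.obj n) ⊗ Δ[1] ⟶ elementsNerve.{u}.obj (stdSimplex.obj n) where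
  app q := ↾fun z => contractionFun z.1.1 (stdSimplex.objEquiv z.1.2).op (edgeFunctor z.2)
  naturality p q t := by
    refine ConcreteCategory.hom_ext _ _ fun ⟨⟨c, α⟩, φ⟩ => ?_
    exact contractionFun_res t c (stdSimplex.objEquiv α).op (edgeFunctor φ)

end SSet

/-! ### The first vertex map is a weak equivalence -/

namespace SSet

open Simplicial Limits HomotopicalAlgebra modelCategoryQuillen CartesianMonoidalCategory

lemma anodyneExtensions.ι₀ (X : SSet.{u}) : anodyneExtensions (SSet.ι₀ : X ⟶ X ⊗ Δ[1]) := by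
  refine .of_exists_lift fun E B p _ f b w => ?_
  obtain ⟨l, h₁, -, h₂⟩ := exists_homotopy_extension_zero (initial.to X) p f
    ((initialIsInitial.ofStrict (fst _ _)).to E) b (initialIsInitial.hom_ext _ _) w
    ((initialIsInitial.ofStrict (fst _ _)).hom_ext _ _)
  exact ⟨l, h₁, h₂⟩

lemma anodyneExtensions.ι₁ (X : SSet.{u}) : anodyneExtensions (SSet.ι₁ : X ⟶ X ⊗ Δ[1]) := by
  refine .of_exists_lift fun E B p _ f b w => ?_
  obtain ⟨l, h₁, -, h₂⟩ := exists_homotopy_extension_one (initial.to X) p f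
    ((initialIsInitial.ofStrict (fst _ _)).to E) b (initialIsInitial.hom_ext _ _) w
    ((initialIsInitial.ofStrict (fst _ _)).hom_ext _ _)
  exact ⟨l, h₁, h₂⟩

instance mono_of_point {X : SSet.{u}} (f : Δ[0] ⟶ X) : Mono f :=
  stdSimplex.isTerminalObj₀.mono_from f

/-- A vertex to which a simplicial set contracts is an anodyne extension. -/
lemma anodyneExtensions.of_contraction {X : SSet.{u}} (x : X _⦋0⦌) (h : X ⊗ Δ[1] ⟶ X)
    (h₀ : SSet.ι₀ ≫ h = SSet.const x) (h₁ : SSet.ι₁ ≫ h = 𝟙 X)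
    (hx : (SSet.const x : Δ[0] ⟶ X) ▷ _ ≫ h = SSet.const x) :
    anodyneExtensions (SSet.const x : Δ[0] ⟶ X) :=
  .of_deformation _ (stdSimplex.isTerminalObj₀.from X) h (by rw [h₀, comp_const]) h₁
    (by rw [hx, comp_const])

/-- The contraction of a standard simplex to its first vertex, on simplices. -/
def coneFun {m n : ℕ} (α : ⦋m⦌ ⟶ ⦋n⦌) (φ : ⦋m⦌ ⟶ ⦋1⦌) : ⦋m⦌ ⟶ ⦋n⦌ :=
  SimplexCategory.Hom.mk
    { toFun i := if φ.toOrderHom i = 0 then 0 else α.toOrderHom i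
      monotone' i j hij := by
        have h := φ.toOrderHom.monotone hij
        dsimp only
        split_ifs with h₁ h₂
        · exact le_rfl
        · exact Fin.zero_le _
        · rename_i h₂
          rw [h₂] at h
          exact absurd (le_antisymm h (Fin.zero_le _)) h₁
        · exact α.toOrderHom.monotone hij }

/-- The contraction of a standard simplex to its first vertex. -/
def stdSimplexContraction (n : ℕ) : (Δ[n] : SSet.{u}) ⊗ Δ[1] ⟶ Δ[n] where
  app q := ↾fun z => stdSimplex.objEquiv.symm
    (coneFun (m := q.unop.len) (stdSimplex.objEquiv z.1) (stdSimplex.objEquiv z.2))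

lemma anodyneExtensions_firstVertex (n : ℕ) :
    anodyneExtensions (SSet.const (stdSimplex.obj₀Equiv.symm 0) : Δ[0] ⟶ (Δ[n] : SSet.{u})) := by
  refine .of_contraction _ (stdSimplexContraction n) ?_ ?_ ?_
  · refine hom_ext_app fun q x => stdSimplex.objEquiv.injective ?_
    ext i : 3
    exact if_pos (c := (stdSimplex.objEquiv (SSet.ι₀.app q x).2).toOrderHom i = 0)
      (e := (stdSimplex.objEquiv x).toOrderHom i) rfl
  · refine hom_ext_app fun q x => stdSimplex.objEquiv.injective ?_
    ext i : 3
    exact if_neg (c := (stdSimplex.objEquiv (SSet.ι₁.app q x).2).toOrderHom i = 0)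
      (t := 0) (one_ne_zero (α := Fin 2))
  · refine hom_ext_app fun q x => stdSimplex.objEquiv.injective ?_
    ext i : 3
    exact ite_self _

/-- The vertex of the nerve of the category of elements of a standard simplex given by the
nondegenerate simplex. -/
def elementsVertex (n : ℕ) : (elementsNerve.{u}.obj Δ[n]) _⦋0⦌ :=
  ⟨(Functor.const _).obj (op ⦋n⦌), stdSimplex.objEquiv.symm (𝟙 _)⟩

lemma switch_id_const {J : Type u} [Category.{v} J] {D : Type u'} [Category.{v'} D] (d : D)
    (φ : J ⥤ Fin 2) :
    NatTrans.switch (𝟙 ((Functor.const J).obj d)) φ = (Functor.const J).obj d := by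
  rw [NatTrans.switch, NatTrans.arrows_const]
  exact Functor.hext (fun _ => rfl) fun _ _ _ => heq_of_eq (Category.id_comp _)

lemma heq_toSwitch_id_const {J : Type u} [Category.{v} J] {D : Type u'} [Category.{v'} D] (d : D)
    (φ : J ⥤ Fin 2) (j : J) :
    HEq (NatTrans.toSwitch (𝟙 ((Functor.const J).obj d)) φ j) (𝟙 d) := by
  have h : ∀ F : J ⥤ ComposableArrows D 1,
    F = (Functor.const J).obj ((Functor.const (Fin 2)).obj d) →
    HEq ((F.obj j).map (homOfLE (Fin.zero_le (φ.obj j)))) (𝟙 d) := by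
    rintro _ rfl
    rfl
  exact h _ (NatTrans.arrows_const d)

lemma elementsSimplex_ext {n : SimplexCategory} {q : SimplexCategoryᵒᵖ}
    {c c' : OperatorChain q} (h : c = c') {a : op n ⟶ c.obj 0} {a' : op n ⟶ c'.obj 0}
    (ha : HEq a a') :
    (⟨c, stdSimplex.objEquiv.symm a.unop⟩ : (elementsNerve.{u}.obj (stdSimplex.obj n)).obj q) =
      ⟨c', stdSimplex.objEquiv.symm a'.unop⟩ := by
  subst h
  rw [eq_of_heq ha]

/-- The contraction fixes its base vertex, as `anodyneExtensions.of_contraction` requires. -/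
lemma contractionFun_id (n : SimplexCategory) (q : SimplexCategoryᵒᵖ)
    (φ : Fin (q.unop.len + 1) ⥤ Fin 2) :
    contractionFun.{u} ((Functor.const _).obj (op n)) (𝟙 (op n)) φ =
      (⟨(Functor.const _).obj (op n), stdSimplex.objEquiv.symm (𝟙 (op n)).unop⟩ :
        (elementsNerve.{u}.obj (stdSimplex.obj n)).obj q) := by
  have e : OperatorChain.cone (q := q) ((Functor.const _).obj (op n)) (𝟙 (op n)) = 𝟙 _ := by
    ext i : 2
    exact Category.comp_id _
  refine (congrArg (fun ν : (Functor.const _).obj (op n) ⟶ (Functor.const _).obj (op n) =>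
    (⟨ν.switch φ, stdSimplex.objEquiv.symm (ν.toSwitch φ 0).unop⟩ :
      (elementsNerve.{u}.obj (stdSimplex.obj n)).obj q)) e).trans ?_
  exact elementsSimplex_ext (switch_id_const _ _) (heq_toSwitch_id_const _ _ _)

lemma const_elementsVertex_app {X : SSet.{u}} (n : ℕ) (q : SimplexCategoryᵒᵖ) (x : X.obj q) :
    (SSet.const (elementsVertex.{u} n)).app q x =
      ⟨(Functor.const _).obj (op ⦋n⦌), stdSimplex.objEquiv.symm (𝟙 (op ⦋n⦌)).unop⟩ :=
  congrArg (Sigma.mk _) (Functor.map_id_apply (stdSimplex.obj ⦋n⦌) (op ⦋n⦌) _)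

/-- The nondegenerate `n`-simplex is an initial object of the category of elements of `Δ[n]`: a
simplex `α` is itself the unique operator leading to it. The contraction is the homotopy from the
constant functor at the initial object to the identity. -/
lemma anodyneExtensions_elementsVertex (n : ℕ) :
    anodyneExtensions (SSet.const (elementsVertex.{u} n) : Δ[0] ⟶ _) := by
  refine .of_contraction _ (contraction ⦋n⦌) ?_ ?_ ?_
  · refine hom_ext_app fun q ⟨c, α⟩ => (?_ : _ = _).trans (const_elementsVertex_app _ _ _).symm
    exact elementsSimplex_ext (NatTrans.switch_zero _) (heq_of_eq (NatTrans.toSwitch_zero _ _))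
  · refine hom_ext_app fun q ⟨c, α⟩ => ?_
    refine elementsSimplex_ext (a' := (stdSimplex.objEquiv α).op) (NatTrans.switch_one _)
      (heq_of_eq ?_)
    exact (congrArg ((stdSimplex.objEquiv α).op ≫ ·) (c.map_id 0)).trans (Category.comp_id _)
  · refine hom_ext_app fun q ⟨x, φ⟩ => ?_
    have h := const_elementsVertex_app n q x
    refine (congrArg (fun y => (contraction ⦋n⦌).app q (y, φ)) h).trans ?_
    exact (contractionFun_id _ _ _).trans (const_elementsVertex_app n q _).symm

lemma const_elementsVertex_firstVertexMap (n : ℕ) :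
    (SSet.const (elementsVertex.{u} n) : Δ[0] ⟶ _) ≫ firstVertexMap.app Δ[n] =
      SSet.const (stdSimplex.obj₀Equiv.symm 0) := by
  rw [const_comp]
  refine congrArg SSet.const (stdSimplex.objEquiv.injective ?_)
  ext i : 3
  rfl

namespace mappingCylinder

/-- The edge `w` of the mapping cylinder joins the vertex `v` of the source to its image, the vertex
`0` of the target. The inclusion of that image in the cylinder is anodyne, hence so is `w` by
cancellation; therefore `v` followed by the source inclusion is anodyne, and cancelling `v`
finishes. -/
lemma anodyne_source_firstVertexMap_stdSimplex (n : ℕ) :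
    anodyneExtensions ((source firstVertexMap.{u}).app Δ[n]) := by
  let v : Δ[0] ⟶ elementsNerve.{u}.obj Δ[n] := SSet.const (elementsVertex n)
  let w : Δ[0] ⊗ Δ[1] ⟶ (mappingCylinder firstVertexMap).obj Δ[n] :=
    v ▷ _ ≫ fromCylinder firstVertexMap Δ[n]
  have hv : anodyneExtensions v := anodyneExtensions_elementsVertex n
  have w₀ : ι₀ ≫ w = v ≫ (source firstVertexMap).app Δ[n] := rfl
  have w₁ : ι₁ ≫ w = (v ≫ firstVertexMap.app Δ[n]) ≫ target firstVertexMap Δ[n] := by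
    refine Eq.trans ?_ (congrArg (v ≫ ·) (ι₁_fromCylinder firstVertexMap Δ[n]))
    rfl
  have : Mono w := by
    have h : ι₁ ≫ snd (elementsNerve.{u}.obj Δ[n]) Δ[1] =
      firstVertexMap.app Δ[n] ≫ SSet.const (stdSimplex.obj₀Equiv.symm 1) := rfl
    -- The projection of the mapping cylinder to `Δ[1]`, constant at `1` on the target; it restricts
    -- along `w` to the projection of `Δ[0] ⊗ Δ[1]`, so `w` is split.
    let d := desc firstVertexMap _ _ h
    have hd : w ≫ d = snd _ _ :=
      congrArg (v ▷ _ ≫ ·) (fromCylinder_desc firstVertexMap _ _ h)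
    have : w ≫ lift (stdSimplex.isTerminalObj₀.from _) d = 𝟙 _ := by
      refine CartesianMonoidalCategory.hom_ext _ _ (stdSimplex.isTerminalObj₀.hom_ext _ _) ?_
      rw [Category.assoc, lift_snd, hd, Category.id_comp]
    exact mono_of_mono_fac this
  have hw : anodyneExtensions w := by
    refine (anodyneExtensions.ι₁ Δ[0]).of_comp ?_
    rw [w₁]
    refine MorphismProperty.comp_mem _ _ _ ?_ (anodyne_target firstVertexMap Δ[n])
    rw [const_elementsVertex_firstVertexMap]
    exact anodyneExtensions_firstVertex n
  refine hv.of_comp ?_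
  rw [← w₀]
  exact MorphismProperty.comp_mem _ _ _ (anodyneExtensions.ι₀ _) hw

end mappingCylinder

end SSet

open SSet SSet.mappingCylinder in
/-- The first vertex map is a weak equivalence. -/
theorem IsWeakEquivalence.firstVertexMap (X : SSet.{u}) :
    IsWeakEquivalence (SSet.firstVertexMap.app X) := by
  have h₁ := IsWeakEquivalence.of_anodyne (anodyne_source SSet.firstVertexMap
    elementsNerveDecomposition anodyne_source_firstVertexMap_stdSimplex X)
  -- By definition `proj` is a retraction of the anodyne `target`.
  have h₂ : IsWeakEquivalence (proj SSet.firstVertexMap X) :=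
    (IsWeakEquivalence.of_anodyne (anodyne_target SSet.firstVertexMap X)).of_comp_left
      (IsWeakEquivalence.id X)
  rw [← source_proj]
  exact h₁.comp h₂

/-! ### Grids in `bA` and their pushforwards -/

namespace SCat

variable (A : SCat.{u}) {p q r : SimplexCategoryᵒᵖ}

lemma levelMap_id_map {X Y : A.Level p} (a : X ⟶ Y) : (A.levelMap (𝟙 p)).map a = a :=
  ConcreteCategory.congr_hom ((A.hom X.obj Y.obj).map_id p) a

lemma levelMap_comp_map (s : p ⟶ q) (t : q ⟶ r) {X Y : A.Level p} (a : X ⟶ Y) :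
    (A.levelMap (s ≫ t)).map a = (A.levelMap t).map ((A.levelMap s).map a) :=
  ConcreteCategory.congr_hom ((A.hom X.obj Y.obj).map_comp s t) a

lemma levelMap_levelFunctor_map {A B : SCat.{u}} (F : A ⟶ B) (t : p ⟶ q) {X Y : A.Level p}
    (a : X ⟶ Y) : (levelFunctor F q).map ((A.levelMap t).map a) =
      (B.levelMap t).map ((levelFunctor F p).map a) :=
  NatTrans.naturality_apply (EnrichedFunctor.map F X.obj Y.obj) t a

end SCat

namespace BObj

variable (A : SCat.{u})

/-- The functor sending an object of `bA` to its dimension. -/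
def dimFunctor : BObj A ⥤ SimplexCategoryᵒᵖ where
  obj := dim
  map f := BHom.op f

variable {A} {J : Type u'} [Category.{v'} J]

/-- A functor to `bA` can be pushed forward along a transformation of the dimensions. -/
def pushforward (F : J ⥤ BObj A) {D : J ⥤ SimplexCategoryᵒᵖ} (σ : F ⋙ dimFunctor A ⟶ D) :
    J ⥤ BObj A where
  obj j := ⟨D.obj j, (F.obj j).obj⟩
  map {j j'} f := (⟨D.map f, (A.levelMap (σ.app j')).map (BHom.levelHom (F.map f))⟩ :
    BHom (A := A) ⟨D.obj j, (F.obj j).obj⟩ ⟨D.obj j', (F.obj j').obj⟩)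
  map_id j := by
    refine BHom.ext (D.map_id j) ?_
    refine Eq.trans ?_ ((A.levelMap (σ.app j)).map_id (SCat.Level.mk (F.obj j).obj))
    exact congrArg (fun g : F.obj j ⟶ F.obj j => (A.levelMap (σ.app j)).map (BHom.levelHom g))
      (F.map_id j)
  map_comp {j j' j''} f g := by
    refine BHom.ext (D.map_comp f g) ?_
    have e₁ := congrArg (fun g : F.obj j ⟶ F.obj j'' =>
      (A.levelMap (σ.app j'')).map (BHom.levelHom g)) (F.map_comp f g)
    have e₂ := (A.levelMap (σ.app j'')).map_comp
      ((A.levelMap (BHom.op (F.map g))).map (BHom.levelHom (F.map f))) (BHom.levelHom (F.map g))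
    refine e₁.trans (e₂.trans (congrArg (· ≫ _) ?_))
    refine (A.levelMap_comp_map _ _ _).symm.trans (Eq.trans ?_
      (A.levelMap_comp_map (σ.app j') (D.map g) (BHom.levelHom (F.map f))))
    exact congrArg (fun t : (F.obj j').dim ⟶ D.obj j'' =>
      (A.hom (F.obj j).obj (F.obj j').obj).map t (BHom.map (F.map f))) (σ.naturality g)

/-- The transformation from a functor to its pushforward. -/
def toPushforward (F : J ⥤ BObj A) {D : J ⥤ SimplexCategoryᵒᵖ} (σ : F ⋙ dimFunctor A ⟶ D) :
    F ⟶ pushforward F σ where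
  app j := BHom.ofOperator (σ.app j) (F.obj j).obj
  naturality j j' f := by
    refine BHom.ext (σ.naturality f) ?_
    refine (Category.comp_id _).trans (Eq.trans ?_ (congrArg (· ≫ _)
      ((A.levelMap (D.map f)).map_id (SCat.Level.mk (F.obj j).obj))).symm)
    exact (Category.id_comp ((A.levelMap (σ.app j')).map (BHom.levelHom (F.map f)))).symm

variable {K : Type u'} [Category.{v'} K] {Q : Type u''} [Category.{v''} Q]

/-- The functor to `bA` given by a diagram of maps of `A_p` and a diagram of simplicial
operators under `p`. -/
def grid {p : SimplexCategoryᵒᵖ} (c : Q ⥤ SimplexCategoryᵒᵖ) (s : (Functor.const Q).obj p ⟶ c)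
    (x : K ⥤ A.Level p) : K × Q ⥤ BObj A where
  obj j := ⟨c.obj j.2, (x.obj j.1).obj⟩
  map {j j'} f := (⟨c.map f.2, (A.levelMap (s.app j'.2)).map (x.map f.1)⟩ :
    BHom (A := A) ⟨c.obj j.2, (x.obj j.1).obj⟩ ⟨c.obj j'.2, (x.obj j'.1).obj⟩)
  map_id j := by
    refine BHom.ext (c.map_id _) ?_
    exact (congrArg (A.levelMap (s.app j.2)).map (x.map_id j.1)).trans
      ((A.levelMap (s.app j.2)).map_id _)
  map_comp {j j' j''} f g := by
    refine BHom.ext (c.map_comp _ _) ?_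
    refine (congrArg (A.levelMap (s.app j''.2)).map (x.map_comp f.1 g.1)).trans ?_
    refine ((A.levelMap (s.app j''.2)).map_comp _ _).trans (congrArg (· ≫ _) ?_)
    refine Eq.trans ?_ (A.levelMap_comp_map (s.app j'.2) (c.map g.2) (x.map f.1))
    exact congrArg (fun t : p ⟶ c.obj j''.2 =>
        (A.hom (x.obj j.1).obj (x.obj j'.1).obj).map t (x.map f.1))
      ((Category.id_comp _).symm.trans (s.naturality g.2))

end BObj

namespace BIdentity

variable {A : SCat.{u}}

lemma obj_eq {X Y : BObj A} {w : X ⟶ Y} (hw : BIdentity A w) : X.obj = Y.obj := by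
  cases hw
  rfl

lemma pushforward {X Y : BObj A} {w : X ⟶ Y} (hw : BIdentity A w) {d e : SimplexCategoryᵒᵖ}
    (t : d ⟶ e) (s : Y.dim ⟶ e) :
    BIdentity A (X := ⟨d, X.obj⟩) (Y := ⟨e, Y.obj⟩)
      (show BHom _ _ from ⟨t, (A.levelMap s).map (BHom.levelHom w)⟩) := by
  obtain ⟨t', a⟩ := hw
  have e : (⟨t, (A.levelMap s).map (BHom.levelHom (BHom.ofOperator t' a))⟩ :
      BHom (A := A) ⟨d, a⟩ ⟨e, a⟩) = BHom.ofOperator t a :=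
    BHom.ext rfl ((A.levelMap s).map_id _)
  exact e ▸ BIdentity.mk t a

/-- With `w = (t₁, id)` and `w' = (t₂, id)`, commutativity of the square says that the map in `a` is
the image under `t₂` of the map in `b`. Equality is heterogeneous because the objects of `A` on the
two sides agree only propositionally. -/
lemma heq_of_commSq {X X' Y Y' : BObj A} {w : X ⟶ X'} {w' : Y ⟶ Y'} (hw : BIdentity A w)
    (hw' : BIdentity A w') {b : X ⟶ Y} {a : X' ⟶ Y'} (h : b ≫ w' = w ≫ a)
    {d e : SimplexCategoryᵒᵖ} (t : d ⟶ e) (s : Y'.dim ⟶ e) :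
    HEq (⟨t, (A.levelMap (BHom.op w' ≫ s)).map (BHom.levelHom b)⟩ :
        BHom (A := A) ⟨d, X.obj⟩ ⟨e, Y.obj⟩)
      (⟨t, (A.levelMap s).map (BHom.levelHom a)⟩ : BHom (A := A) ⟨d, X'.obj⟩ ⟨e, Y'.obj⟩) := by
  cases hw with | mk t₁ a₁ =>
  cases hw' with | mk t₂ a₂ =>
  refine heq_of_eq (BHom.ext rfl ?_)
  refine (A.levelMap_comp_map _ _ _).trans (congrArg (A.levelMap s).map ?_)
  have e := congrArg BHom.map h
  have e₁ : BHom.map (b ≫ BHom.ofOperator t₂ a₂) = (A.levelMap t₂).map (BHom.levelHom b) :=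
    Category.comp_id _
  have e₂ : BHom.map (BHom.ofOperator t₁ a₁ ≫ a) = BHom.levelHom a :=
    (congrArg (· ≫ _) ((A.levelMap _).map_id _)).trans (Category.id_comp _)
  exact e₁.symm.trans (e.trans e₂)

end BIdentity

namespace CategoryTheory.NatTrans

variable {J : Type u} [Category.{v} J] {D : Type u'} [Category.{v'} D]

lemma switch_mem (W : MorphismProperty D) [W.IsMultiplicative] {F G : J ⥤ D} (ν : F ⟶ G)
    (hν : ∀ j, W (ν.app j)) (φ : J ⥤ Fin 2) {j j' : J} (f : j ⟶ j') (hF : W (F.map f))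
    (hG : W (G.map f)) : W ((ν.switch φ).map f) := by
  have h₁ (a : Fin 2) : W ((ν.arrows.map f).app a) := by
    fin_cases a
    · exact hF
    · exact hG
  have h₂ (a b : Fin 2) (g : a ⟶ b) : W ((ν.arrows.obj j').map g) := by
    fin_cases a <;> fin_cases b
    · exact ((ν.arrows.obj j').map_id 0) ▸ W.id_mem _
    · exact hν j'
    · exact absurd (leOfHom g) (by decide)
    · exact ((ν.arrows.obj j').map_id 1) ▸ W.id_mem _
  exact W.comp_mem _ _ (h₁ _) (h₂ _ _ _)

end CategoryTheory.NatTrans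

instance (A : SCat.{u}) : (BIdentity A).IsMultiplicative where
  id_mem := (relativizationObj A).id_mem
  comp_mem := (relativizationObj A).comp_mem

namespace BObj

open SSet

variable {A : SCat.{u}} {k q : SimplexCategoryᵒᵖ}

/-- The cone on a chain given by its start. -/
def fromStart (c : OperatorChain q) : (Functor.const _).obj (c.obj 0) ⟶ c where
  app i := c.from0 i
  naturality _ _ f := (Category.id_comp _).trans (c.from0_map f).symm

/-- The retraction of a grid onto its last column. -/
abbrev collapse (k q : SimplexCategoryᵒᵖ) :
    Fin (k.unop.len + 1) × Fin (q.unop.len + 1) ⥤ Fin (k.unop.len + 1) × Fin (q.unop.len + 1) :=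
  CategoryTheory.Prod.snd _ _ ⋙ Prod.sectR (Fin.last k.unop.len) _

/-- The transformation from the identity to the retraction of a grid onto its last column. -/
def toCollapse (k q : SimplexCategoryᵒᵖ) : 𝟭 _ ⟶ collapse k q where
  app j := (homOfLE (Fin.le_last j.1), 𝟙 j.2)
  naturality _ _ _ := Prod.ext (Subsingleton.elim _ _) (Subsingleton.elim _ _)

variable (F : Fin (k.unop.len + 1) × Fin (q.unop.len + 1) ⥤ BObj A)

/-- The dimensions in the last column of a grid in `bA`. -/
abbrev lastDims : OperatorChain q :=
  Prod.sectR (Fin.last k.unop.len) _ ⋙ F ⋙ dimFunctor A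

/-- The simplicial operators from the dimensions in a grid to those in its last column. -/
abbrev toLastDims : F ⋙ dimFunctor A ⟶ CategoryTheory.Prod.snd _ _ ⋙ lastDims F :=
  Functor.whiskerRight (toCollapse k q) (F ⋙ dimFunctor A)

/-- The chain of maps in the first row of a grid in `bA`, pushed forward to the last column. -/
def firstRow : Fin (k.unop.len + 1) ⥤ A.Level ((lastDims F).obj 0) where
  obj i := ⟨(F.obj (i, 0)).obj⟩
  map {i i'} f := (A.levelMap ((toLastDims F).app (i', 0))).map
    (BHom.levelHom (F.map (X := (i, 0)) (Y := (i', 0)) (f, 𝟙 _)))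
  map_id i := congrArg BHom.map ((pushforward F (toLastDims F)).map_id (i, 0))
  map_comp {i i' i''} f g := by
    refine (congrArg BHom.map ((pushforward F (toLastDims F)).map_comp
      (X := (i, 0)) (Y := (i', 0)) (Z := (i'', 0)) (f, 𝟙 _) (g, 𝟙 _))).trans ?_
    refine congrArg (· ≫ _) (?_ : (A.levelMap ((lastDims F).map (𝟙 0))).map _ = _)
    rw [(lastDims F).map_id]
    exact A.levelMap_id_map _

/-- The maps within a column have the form `(t, id)`, so the object of `A` is constant along each
column, and `heq_of_commSq` shows every row to be the transport of the first one. After the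
pushforward the dimensions depend only on the row, so the data form a grid. -/
lemma grid_firstRow
    (hF : ∀ i j, BIdentity A (F.map (X := (i, 0)) (Y := (i, j)) (𝟙 i, homOfLE (Fin.zero_le j)))) :
    grid (lastDims F) (fromStart (lastDims F)) (firstRow F) = pushforward F (toLastDims F) := by
  refine Functor.hext (fun j => ?_) (fun j j' f => ?_)
  · exact congrArg (BObj.mk _) (hF j.1 j.2).obj_eq
  · let b : F.obj (j.1, 0) ⟶ F.obj (j'.1, 0) := F.map (f.1, 𝟙 _)
    have h : b ≫ F.map (X := (j'.1, 0)) (Y := j') (𝟙 _, homOfLE (Fin.zero_le j'.2)) =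
        F.map (X := (j.1, 0)) (Y := j) (𝟙 _, homOfLE (Fin.zero_le j.2)) ≫ F.map f :=
      (F.map_comp _ _).symm.trans
        (F.map_comp (X := (j.1, 0)) (Y := j) (Z := j') (𝟙 j.1, homOfLE (Fin.zero_le j.2)) f)
    have e := BIdentity.heq_of_commSq (hF j.1 j.2) (hF j'.1 j'.2) h ((lastDims F).map f.2)
      ((toLastDims F).app j')
    have e₁ := (toLastDims F).naturality (X := (j'.1, 0)) (Y := j')
      (𝟙 j'.1, homOfLE (Fin.zero_le j'.2))
    have e₂ : (grid (lastDims F) (fromStart (lastDims F)) (firstRow F)).map f =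
        (⟨(lastDims F).map f.2, (A.hom (F.obj (j.1, 0)).obj (F.obj (j'.1, 0)).obj).map
          (BHom.op (F.map (X := (j'.1, 0)) (Y := j') (𝟙 _, homOfLE (Fin.zero_le j'.2))) ≫
            (toLastDims F).app j') (BHom.map b)⟩ :
          BHom (A := A) ⟨(lastDims F).obj j.2, (F.obj (j.1, 0)).obj⟩
            ⟨(lastDims F).obj j'.2, (F.obj (j'.1, 0)).obj⟩) := by
      refine BHom.ext rfl ((A.levelMap_comp_map ((toLastDims F).app (j'.1, 0))
        ((lastDims F).from0 j'.2) (BHom.levelHom b)).symm.trans ?_)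
      exact congrArg (fun t : (F.obj (j'.1, 0)).dim ⟶ (lastDims F).obj j'.2 =>
        (A.hom (F.obj (j.1, 0)).obj (F.obj (j'.1, 0)).obj).map t (BHom.map b)) e₁.symm
    exact (heq_of_eq e₂).trans e

lemma firstRow_grid (c : OperatorChain q) (x : Fin (k.unop.len + 1) ⥤ A.Level (c.obj 0)) :
    firstRow (grid c (fromStart c) x) = x := by
  refine Functor.hext (fun _ => rfl) (fun i i' f => heq_of_eq ?_)
  -- Stated for a variable operator, since the identity arises twice as the image under `c` of an
  -- identity.
  have e (t : c.obj 0 ⟶ c.obj 0) (ht : t = 𝟙 _) {X Y : A.Level (c.obj 0)} (a : X ⟶ Y) :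
      (A.levelMap t).map a = a := by
    subst ht
    exact A.levelMap_id_map a
  exact (e (c.map (𝟙 0)) (c.map_id 0) _).trans (e (c.from0 0) (c.map_id 0) (x.map f))

end BObj

/-! ### The grid comparison is a homotopy equivalence; the zigzag -/

namespace SSet

open Simplicial Limits HomotopicalAlgebra modelCategoryQuillen CartesianMonoidalCategory
open RelativeCat BObj

variable (A : SCat.{u}) (k : SimplexCategoryᵒᵖ)

/-- The `q`-simplices of the simplicial nerve of the relativization in a given dimension. -/
abbrev RelSimplex (q : SimplexCategoryᵒᵖ) : Type u :=
  RelFunctor ((hat k.unop).prod (check q.unop)) (relativizationObj A)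

variable {A k} in
lemma RelSimplex.ext {q : SimplexCategoryᵒᵖ} {y y' : RelSimplex A k q}
    (h : y.toFunctor = y'.toFunctor) : y = y' := RelFunctor.ext h

/-- The underlying functor of a simplex. -/
abbrev RelSimplex.functor {A : SCat.{u}} {k q : SimplexCategoryᵒᵖ} (y : RelSimplex A k q) :
    Fin (k.unop.len + 1) × Fin (q.unop.len + 1) ⥤ BObj A := y.toFunctor

/-- The simplex given by a chain of operators and a chain of maps. -/
def gridSimplex {q : SimplexCategoryᵒᵖ} (c : OperatorChain q)
    (x : Fin (k.unop.len + 1) ⥤ A.Level (c.obj 0)) : RelSimplex A k q where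
  toFunctor := grid c (fromStart c) x
  map_mem := by
    rintro ⟨i, j⟩ ⟨i', j'⟩ ⟨f, g⟩ ⟨h, -⟩
    obtain rfl : i = i' := h
    have e : (grid c (fromStart c) x).map (X := (i, j)) (Y := (i, j')) (f, g) =
        (show BHom _ _ from BHom.ofOperator (c.map g) (x.obj i).obj) := by
      refine BHom.ext rfl ?_
      exact (congrArg (A.levelMap (c.from0 j')).map (x.map_id i)).trans
        ((A.levelMap (c.from0 j')).map_id _)
    exact e ▸ BIdentity.mk _ _

/-- The comparison of the nerve of the category of elements of the flipped nerve with the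
simplicial nerve of the relativization. -/
def gridMap : elementsNerve.{u}.obj ((flippedNerve.obj A).obj k) ⟶
    (simplicialNerve.obj (relativization.obj A)).obj k where
  app q := ↾fun z => gridSimplex A k z.1 z.2
  naturality p q t := by
    refine ConcreteCategory.hom_ext _ _ fun ⟨c, x⟩ => RelSimplex.ext ?_
    refine Functor.hext (fun _ => rfl) fun j j' f => heq_of_eq (BHom.ext rfl ?_)
    refine (A.levelMap_comp_map _ _ _).symm.trans ?_
    exact congrArg (fun t : c.obj 0 ⟶ c.obj _ => (A.hom _ _).map t _) (c.from0_map _)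

end SSet

namespace SSet

open Simplicial Limits HomotopicalAlgebra modelCategoryQuillen CartesianMonoidalCategory
open RelativeCat BObj

/-- A factorization through an injective map on all simplices is a map of simplicial sets. -/
def liftOfInjective {X Y Z : SSet.{u}} (f : X ⟶ Y) (hf : ∀ q, Function.Injective (f.app q))
    (g : Z ⟶ Y) (s : ∀ q, Z.obj q → X.obj q) (hs : ∀ q z, f.app q (s q z) = g.app q z) :
    Z ⟶ X where
  app q := ↾s q
  naturality p q t := by
    refine ConcreteCategory.hom_ext _ _ fun z => hf q ?_
    refine (hs q (Z.map t z)).trans (Eq.trans ?_ (NatTrans.naturality_apply f t (s p z)).symm)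
    exact (NatTrans.naturality_apply g t z).trans (congrArg (Y.map t) (hs p z)).symm

variable (A : SCat.{u}) (k : SimplexCategoryᵒᵖ)

/-- The simplices of the homotopy from the identity of the simplicial nerve of the
relativization to the retraction onto the image of `gridMap`. -/
def relHomotopyFun {A : SCat.{u}} {k q : SimplexCategoryᵒᵖ} (y : RelSimplex A k q)
    (φ : Fin (q.unop.len + 1) ⥤ Fin 2) : RelSimplex A k q where
  toFunctor := (toPushforward y.functor (toLastDims y.functor)).switch
    (CategoryTheory.Prod.snd _ _ ⋙ φ)
  map_mem f hf := by
    refine NatTrans.switch_mem (BIdentity A) _ (fun j => ?_) _ f (y.map_mem f hf) ?_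
    · exact BIdentity.mk _ _
    · exact BIdentity.pushforward (y.map_mem f hf) _ _

/-- The homotopy from the identity of the simplicial nerve of the relativization to the
retraction onto the image of `gridMap`. -/
def relHomotopy : (simplicialNerve.obj (relativization.obj A)).obj k ⊗ Δ[1] ⟶
    (simplicialNerve.obj (relativization.obj A)).obj k where
  app q := ↾fun z => relHomotopyFun (A := A) (k := k) (q := q) z.1 (edgeFunctor z.2)
  naturality p q t := by
    refine ConcreteCategory.hom_ext _ _ fun ⟨y, φ⟩ => RelSimplex.ext ?_
    rfl

lemma ι₀_relHomotopy : ι₀ ≫ relHomotopy A k = 𝟙 _ :=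
  hom_ext_app fun _ _ => RelSimplex.ext (NatTrans.switch_zero _)

variable {A k} in
lemma toFunctor_ι₁_relHomotopy {q : SimplexCategoryᵒᵖ} (y : RelSimplex A k q) :
    RelSimplex.functor (A := A) (k := k) (q := q) ((ι₁ ≫ relHomotopy A k).app q y) =
      pushforward y.functor (toLastDims y.functor) :=
  NatTrans.switch_one _

lemma gridMap_injective (q : SimplexCategoryᵒᵖ) : Function.Injective ((gridMap A k).app q) := by
  refine Function.LeftInverse.injective (g := fun y : RelSimplex A k q =>
    (⟨lastDims y.functor, firstRow y.functor⟩ : (elementsNerve.{u}.obj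
      ((flippedNerve.obj A).obj k)).obj q)) fun ⟨c, x⟩ => ?_
  exact congrArg (Sigma.mk c) (firstRow_grid c x)

variable {A k} in
lemma gridMap_firstRow {q : SimplexCategoryᵒᵖ} (y : RelSimplex A k q) :
    (gridMap A k).app q ⟨lastDims y.functor, firstRow y.functor⟩ =
      (ι₁ ≫ relHomotopy A k).app q y := by
  refine RelSimplex.ext (Eq.trans ?_ (toFunctor_ι₁_relHomotopy y).symm)
  exact grid_firstRow y.functor fun i j => y.map_mem _ ⟨rfl, trivial⟩

/-- The homotopy inverse of `gridMap`. -/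
noncomputable def gridInverse : (simplicialNerve.obj (relativization.obj A)).obj k ⟶
    elementsNerve.{u}.obj ((flippedNerve.obj A).obj k) :=
  liftOfInjective (gridMap A k) (gridMap_injective A k) (ι₁ ≫ relHomotopy A k)
    (fun q (y : RelSimplex A k q) => ⟨lastDims y.functor, firstRow y.functor⟩)
    fun _ y => gridMap_firstRow y

lemma gridInverse_gridMap : gridInverse A k ≫ gridMap A k = ι₁ ≫ relHomotopy A k :=
  hom_ext_app fun _ y => gridMap_firstRow y

lemma gridMap_gridInverse : gridMap A k ≫ gridInverse A k = 𝟙 _ :=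
  hom_ext_app fun _ ⟨c, x⟩ => congrArg (Sigma.mk c) (firstRow_grid c x)

/-- Only `gridMap` has to be natural in `A` and `k`. The inverse and the homotopy single out the
last column and serve for one fixed `k`. -/
lemma isWeakEquivalence_gridMap : IsWeakEquivalence (gridMap A k) :=
  .of_homotopyEquivalence (gridInverse A k)
    (.ofHom (relHomotopy A k) (ι₀_relHomotopy A k) (gridInverse_gridMap A k).symm)
    (gridMap_gridInverse A k)

/-- The comparison of the nerves of the categories of elements of the flipped nerve with the
simplicial nerve of the relativization, as a transformation of functors. -/
def gridTransformation : flippedNerve.{u} ⋙ (Functor.whiskeringRight _ _ _).obj elementsNerve.{u} ⟶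
    relativization.{u} ⋙ simplicialNerve.{u} where
  app A :=
    { app k := gridMap A k
      naturality k k' s := rfl }
  naturality A B F := by
    refine NatTrans.ext (funext fun k => hom_ext_app fun q ⟨c, x⟩ => RelSimplex.ext ?_)
    refine Functor.hext (fun _ => rfl) fun j j' f => heq_of_eq (BHom.ext rfl ?_)
    exact (SCat.levelMap_levelFunctor_map F _ _).symm

/-- The first vertex maps of the flipped nerve, as a transformation of functors. -/
def firstVertexTransformation :
    flippedNerve.{u} ⋙ (Functor.whiskeringRight _ _ _).obj elementsNerve.{u} ⟶
      flippedNerve.{u} :=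
  Functor.whiskerLeft _ ((Functor.whiskeringRight _ _ _).map firstVertexMap) ≫
    (Functor.rightUnitor _).hom

end SSet

theorem proposition2p5 :
    NaturallyReedyEquivalent (relativization.{u} ⋙ simplicialNerve.{u}) flippedNerve.{u} := by
  refine .trans _ _ _ (.symm _ _ (.rel _ _ ⟨SSet.gridTransformation, fun A k => ?_⟩))
    (.rel _ _ ⟨SSet.firstVertexTransformation, fun A k => ?_⟩)
  · exact SSet.isWeakEquivalence_gridMap A k
  · exact IsWeakEquivalence.firstVertexMap _
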